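/- Let $(M,g)$ be a Lorentzian manifold (smooth, finite-dimensional) and let $L$ be a totally geodesic null hypersurface of $M$, with inclusion (an immersion of codimension one) $i\colon L\to M$; that is, $i^*g$ is degenerate on every tangent space of $L$, and $\nabla_UV$ is tangent to $L$ whenever $U,V$ are tangent to $L$ along $L$, where $\nabla$ is the Levi-Civita connection of $g$. Let $\zeta$ be a rigging for $L$: a smooth vector field on an open set containing $L$ with $\zeta_p\notin T_pL$ for every $p\in L$. Put $\alpha=g(\zeta,\cdot)$, and let $\omega=i^*\alpha$ be the rigged 1-form, $\widetilde g=i^*(g+\alpha\otimes\alpha)$ the rigged metric on $L$, $\xi$ the rigged vector field on $L$, defined by $\widetilde g(\xi,\cdot)=\omega$, and $\mathcal S^{\zeta}=\ker\omega=\xi^{\perp_{\widetilde g}}\subset TL$ the screen distribution. Then $\xi$ is smooth and nowhere zero, and its flow $F$ is a Riemannian flow with bundle-like metric $\widetilde g$: $\widetilde g$ is a Riemannian metric, and the metric it induces on $Q=TL/TF\cong\mathcal S^{\zeta}$ satisfies $V\widetilde g(X,Y)-\widetilde g(\pi[V,X],Y)-\widetilde g(X,\pi[V,Y])=0$ for all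 $V$ tangent to $F$ and all sections $X,Y$ of $\mathcal S^\zeta$, where $\pi\colon TL\to\mathcal S^{\zeta}$ is the $\widetilde g$-orthogonal projection. Let $\widetilde\nabla$ be the Levi-Civita connection of $\widetilde g$, and let $\nabla^T$ be the transverse connection on $Q=\mathcal S^\zeta$, given for sections $Y$ of $\mathcal S^\zeta$ by $\nabla^T_XY=\pi[X,Y]$ if $X$ is tangent to $F$ and $\nabla^T_XY=\pi(\widetilde\nabla_XY)$ if $X$ is a section of $\mathcal S^\zeta$. Let $R^T(X,Y)Z=\nabla^T_X\nabla^T_YZ-\nabla^T_Y\nabla^T_XZ-\nabla^T_{[X,Y]}Z$. Then for all (local, smooth) sections $X,Y$ of $\mathcal S^\zeta$ that are orthonormal at a point $p\in L$, the transverse sectional curvature $K^T(X,Y)=\widetilde g(R^T(X,Y)Y,X)$ satisfies at $p$ $$K^T(X,Y)=\widetilde K(X,Y)+\tfrac34\,d\omega(X,Y)^2=K(X,Y),$$ where $\widetilde K$ is the sectional curvature of $(L,\widetilde g)$, $K(X,Y)$ is the sectional curvature in $(M,g)$ of the plane spanned by $i_*X_p$ and $i_*Y_p$, and $d\omega(X,Y)=X(\omega(Y))-Y(\omega(X))-\omega([X,Y])$.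 -/

import Mathlib

open Bundle
open scoped Manifold ContDiff Topology

noncomputable section

namespace RiggedNull

/-! ### Vector fields and covariant 2-tensors on a manifold without boundary -/

section Basic

variable {E : Type*} [NormedAddCommGroup E] [NormedSpace ℝ E]
  {M : Type*} [TopologicalSpace M] [ChartedSpace E M]

/-- A (not necessarily smooth) vector field on `M`. -/
abbrev VField (E : Type*) [NormedAddCommGroup E] [NormedSpace ℝ E]
    (M : Type*) [TopologicalSpace M] [ChartedSpace E M] : Type _ :=
  (p : M) → TangentSpace 𝓘(ℝ, E) p

/-- A (not necessarily smooth) field of bilinear forms on the tangent spaces of `M`. -/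
abbrev BilinField (E : Type*) [NormedAddCommGroup E] [NormedSpace ℝ E]
    (M : Type*) [TopologicalSpace M] [ChartedSpace E M] : Type _ :=
  (p : M) → TangentSpace 𝓘(ℝ, E) p →L[ℝ] TangentSpace 𝓘(ℝ, E) p →L[ℝ] ℝ

/-- The vector field `X` is smooth at `p`. -/
def SmoothAt [IsManifold 𝓘(ℝ, E) ∞ M] (X : VField E M) (p : M) : Prop :=
  ContMDiffAt 𝓘(ℝ, E) 𝓘(ℝ, E).tangent ∞ (fun q => (⟨q, X q⟩ : TangentBundle 𝓘(ℝ, E) M)) p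

/-- The derivative `X f` of a function `f` along a vector field `X`. -/
def dirDeriv (X : VField E M) (f : M → ℝ) (p : M) : ℝ :=
  mvfderiv 𝓘(ℝ, E) f p (X p)

/-- The Lie bracket `[X, Y]`. -/
def bracket (X Y : VField E M) : VField E M :=
  VectorField.mlieBracket 𝓘(ℝ, E) X Y

/-- The right-hand side of the Koszul formula: `koszul h X Y Z` is the value that `h(∇_X Y, Z)`
has for the Levi-Civita connection `∇` of the (pseudo-)Riemannian metric `h`. -/
def koszul (h : BilinField E M) (X Y Z : VField E M) (p : M) : ℝ :=
  (1 / 2) * (dirDeriv X (fun q => h q (Y q) (Z q)) p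
    + dirDeriv Y (fun q => h q (Z q) (X q)) p
    - dirDeriv Z (fun q => h q (X q) (Y q)) p
    + h p (bracket X Y p) (Z p)
    - h p (bracket Y Z p) (X p)
    + h p (bracket Z X p) (Y p))

/-- The Levi-Civita covariant derivative `∇_X Y` of a (pseudo-)Riemannian metric `h`: at `p` it is
the tangent vector `v` with `h(v, Z) = koszul h X Y Z` for every vector field `Z` differentiable
at `p` (existing and unique if `X`, `Y` are differentiable at `p`, and `h` is differentiable,
symmetric and nondegenerate; arbitrary otherwise). -/
def leviCivita [IsManifold 𝓘(ℝ, E) ∞ M] (h : BilinField E M) (X Y : VField E M) : VField E M := fun p =>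
  Classical.epsilon fun v : TangentSpace 𝓘(ℝ, E) p =>
    ∀ Z : VField E M,
      MDifferentiableAt 𝓘(ℝ, E) 𝓘(ℝ, E).tangent
        (fun q => (⟨q, Z q⟩ : TangentBundle 𝓘(ℝ, E) M)) p →
      h p v (Z p) = koszul h X Y Z p

/-- For an operation `(X, Y) ↦ D_X Y` on vector fields, the curvature
`R(X, Y) Z = D_X D_Y Z - D_Y D_X Z - D_{[X, Y]} Z`. -/
def curvature (D : VField E M → VField E M → VField E M) (X Y Z : VField E M) : VField E M :=
  fun p => D X (D Y Z) p - D Y (D X Z) p - D (bracket X Y) Z p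

/-- The sectional curvature, at the point `p`, of the plane spanned by `X p` and `Y p`, for the
(pseudo-)Riemannian metric `h`. -/
def sectionalCurvature [IsManifold 𝓘(ℝ, E) ∞ M] (h : BilinField E M) (X Y : VField E M) (p : M) : ℝ :=
  h p (curvature (leviCivita h) X Y Y p) (X p) /
    (h p (X p) (X p) * h p (Y p) (Y p) - h p (X p) (Y p) ^ 2)

/-- The exterior derivative of a 1-form, `dη(X, Y) = X η(Y) - Y η(X) - η([X, Y])`. -/
def extDerivOneForm (η : (p : M) → TangentSpace 𝓘(ℝ, E) p →L[ℝ] ℝ) (X Y : VField E M)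
    (p : M) : ℝ :=
  dirDeriv X (fun q => η q (Y q)) p - dirDeriv Y (fun q => η q (X q)) p - η p (bracket X Y p)

/-- `g` is a smooth Lorentzian metric: smooth, symmetric, and at every point there is a vector
`t` with `g(t, t) < 0` on whose orthogonal complement `g` is positive definite. -/
structure IsLorentzMetric [IsManifold 𝓘(ℝ, E) ∞ M] (g : BilinField E M) : Prop where
  smooth : ContMDiff 𝓘(ℝ, E) (𝓘(ℝ, E).prod 𝓘(ℝ, E →L[ℝ] E →L[ℝ] ℝ)) ∞
    (fun p => TotalSpace.mk' (E →L[ℝ] E →L[ℝ] ℝ)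
      (E := fun p : M => TangentSpace 𝓘(ℝ, E) p →L[ℝ] TangentSpace 𝓘(ℝ, E) p →L[ℝ] ℝ) p (g p))
  symm : ∀ p u v, g p u v = g p v u
  signature : ∀ p, ∃ t, g p t t < 0 ∧ ∀ v, g p t v = 0 → v ≠ 0 → 0 < g p v v

/-! ### The transverse geometry of a flow

`h` is a Riemannian metric, and `ξ` is a nowhere vanishing vector field which spans the tangent
bundle `TF` of a one-dimensional foliation `F`. The bundle `Q = TM / TF` is identified with the
`h`-orthogonal complement of `TF`, the projection `TM → Q` being the orthogonal projection. -/

/-- The component of `X` tangent to the flow. -/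
def vertical (h : BilinField E M) (ξ X : VField E M) : VField E M := fun p =>
  (h p (X p) (ξ p) / h p (ξ p) (ξ p)) • ξ p

/-- The component of `X` orthogonal to the flow, that is, the projection of `X` to `Q`. -/
def horizontal (h : BilinField E M) (ξ X : VField E M) : VField E M := fun p =>
  X p - vertical h ξ X p

/-- The flow of `ξ` is a Riemannian flow with bundle-like metric `h`: `ξ` is smooth and nowhere
zero, `h` is a smooth Riemannian metric (it is symmetric and positive definite, and maps smooth
vector fields to smooth functions), and the metric it induces on `Q` is holonomy invariant:
`(L_V h)(X, Y) = V h(X, Y) - h([V, X], Y) - h(X, [V, Y])` vanishes for `V` tangent to the flow and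
sections `X`, `Y` of `Q`, where the brackets are projected to `Q`. -/
structure IsRiemannianFlow [IsManifold 𝓘(ℝ, E) ∞ M] (h : BilinField E M) (ξ : VField E M) :
    Prop where
  smooth_field : ∀ p, SmoothAt ξ p
  ne_zero : ∀ p, ξ p ≠ 0
  symm : ∀ p u v, h p u v = h p v u
  pos : ∀ p u, u ≠ 0 → 0 < h p u u
  smooth_metric : ∀ (p : M) (X Y : VField E M), SmoothAt X p → SmoothAt Y p →
    ContMDiffAt 𝓘(ℝ, E) 𝓘(ℝ, ℝ) ∞ (fun q => h q (X q) (Y q)) p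
  holonomy_invariant : ∀ (p : M) (V X Y : VField E M),
    SmoothAt V p → SmoothAt X p → SmoothAt Y p →
    (∀ᶠ q in 𝓝 p, horizontal h ξ V q = 0) →
    (∀ᶠ q in 𝓝 p, h q (X q) (ξ q) = 0) → (∀ᶠ q in 𝓝 p, h q (Y q) (ξ q) = 0) →
    dirDeriv V (fun q => h q (X q) (Y q)) p
      - h p (horizontal h ξ (bracket V X) p) (Y p)
      - h p (X p) (horizontal h ξ (bracket V Y) p) = 0

/-- The transverse (basic Levi-Civita) connection `∇ᵀ` of the flow, for a vector field `X` and a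
section `Y` of `Q`: it is `π [X, Y]` for `X` tangent to the flow and `π (∇_X Y)` for `X` orthogonal
to it, where `∇` is the Levi-Civita connection of `h` and `π` is the projection to `Q`. -/
def transverseConnection [IsManifold 𝓘(ℝ, E) ∞ M] (h : BilinField E M) (ξ X Y : VField E M) :
    VField E M := fun p =>
  horizontal h ξ (bracket (vertical h ξ X) Y) p
    + horizontal h ξ (leviCivita h (horizontal h ξ X) Y) p

/-- The transverse sectional curvature `Kᵀ(X, Y) = h(Rᵀ(X, Y) Y, X)` at `p`, for sections
`X`, `Y` of `Q` that are orthonormal at `p`. -/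
def transverseSectionalCurvature [IsManifold 𝓘(ℝ, E) ∞ M] (h : BilinField E M)
    (ξ X Y : VField E M) (p : M) : ℝ :=
  h p (curvature (transverseConnection h ξ) X Y Y p) (X p)

end Basic

/-! ### Null hypersurfaces and riggings -/

section Hypersurface

variable {E : Type*} [NormedAddCommGroup E] [NormedSpace ℝ E]
  {M : Type*} [TopologicalSpace M] [ChartedSpace E M]
  {F : Type*} [NormedAddCommGroup F] [NormedSpace ℝ F]
  {L : Type*} [TopologicalSpace L] [ChartedSpace F L]

/-- The differential of `i : L → M` at `p`. -/
abbrev diff (E : Type*) [NormedAddCommGroup E] [NormedSpace ℝ E]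
    {M : Type*} [TopologicalSpace M] [ChartedSpace E M]
    (F : Type*) [NormedAddCommGroup F] [NormedSpace ℝ F]
    {L : Type*} [TopologicalSpace L] [ChartedSpace F L] (i : L → M) (p : L) :
    TangentSpace 𝓘(ℝ, F) p →L[ℝ] TangentSpace 𝓘(ℝ, E) (i p) :=
  mfderiv 𝓘(ℝ, F) 𝓘(ℝ, E) i p

/-- `i : L → M` is an (immersed) null hypersurface: a smooth immersion of codimension one such
that the bilinear form induced by `g` on every tangent space of `L` is degenerate. -/
structure IsNullHypersurface (F : Type*) [NormedAddCommGroup F]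
    [NormedSpace ℝ F] {L : Type*} [TopologicalSpace L] [ChartedSpace F L]
    (g : BilinField E M) (i : L → M) : Prop where
  immersion : Manifold.IsImmersion 𝓘(ℝ, F) 𝓘(ℝ, E) ∞ i
  codim : Module.finrank ℝ E = Module.finrank ℝ F + 1
  null : ∀ p : L, ∃ u : TangentSpace 𝓘(ℝ, F) p, u ≠ 0 ∧
    ∀ v, g (i p) (diff E F i p u) (diff E F i p v) = 0

/-- The hypersurface `i : L → M` is totally geodesic: `∇_U V` is tangent to `L` for all local
vector fields `U`, `V` of `M` that are tangent to `L` along `L`. -/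
def IsTotallyGeodesic [IsManifold 𝓘(ℝ, E) ∞ M] (F : Type*) [NormedAddCommGroup F]
    [NormedSpace ℝ F] {L : Type*} [TopologicalSpace L] [ChartedSpace F L]
    (g : BilinField E M) (i : L → M) : Prop :=
  ∀ (p : L) (U V : VField E M), SmoothAt U (i p) → SmoothAt V (i p) →
    (∀ᶠ q in 𝓝 p, ∃ u, diff E F i q u = U (i q)) →
    (∀ᶠ q in 𝓝 p, ∃ v, diff E F i q v = V (i q)) →
    ∃ w, diff E F i p w = leviCivita g U V (i p)

/-- `ζ` is a rigging for the hypersurface `i : L → M`: a smooth vector field on an open set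
containing `L` that is nowhere tangent to `L` (its values off that open set are irrelevant). -/
def IsRigging [IsManifold 𝓘(ℝ, E) ∞ M] (F : Type*) [NormedAddCommGroup F]
    [NormedSpace ℝ F] {L : Type*} [TopologicalSpace L] [ChartedSpace F L]
    (i : L → M) (ζ : VField E M) : Prop :=
  (∃ U : Set M, IsOpen U ∧ Set.range i ⊆ U ∧ ∀ q ∈ U, SmoothAt ζ q) ∧
    ∀ p : L, ¬ ∃ u, diff E F i p u = ζ (i p)

/-- The rigged 1-form `ω = i^* α`, with `α = g(ζ, ·)`. -/
def riggedForm (F : Type*) [NormedAddCommGroup F]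
    [NormedSpace ℝ F] {L : Type*} [TopologicalSpace L] [ChartedSpace F L]
    (g : BilinField E M) (i : L → M) (ζ : VField E M) (p : L) :
    TangentSpace 𝓘(ℝ, F) p →L[ℝ] ℝ :=
  (g (i p) (ζ (i p))).comp (diff E F i p)

/-- The rigged metric `g̃ = i^* (g + α ⊗ α)`, with `α = g(ζ, ·)`. -/
def riggedMetric (F : Type*) [NormedAddCommGroup F]
    [NormedSpace ℝ F] {L : Type*} [TopologicalSpace L] [ChartedSpace F L]
    (g : BilinField E M) (i : L → M) (ζ : VField E M) : BilinField F L := fun p =>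
  (ContinuousLinearMap.precomp ℝ (diff E F i p)).comp ((g (i p)).comp (diff E F i p))
    + (riggedForm F g i ζ p).smulRight (riggedForm F g i ζ p)

theorem riggedMetric_apply (g : BilinField E M) (i : L → M) (ζ : VField E M) (p : L)
    (u v : TangentSpace 𝓘(ℝ, F) p) :
    riggedMetric F g i ζ p u v = g (i p) (diff E F i p u) (diff E F i p v)
      + g (i p) (ζ (i p)) (diff E F i p u) * g (i p) (ζ (i p)) (diff E F i p v) := rfl

/-- The rigged vector field `ξ`: the vector field on `L` that is `g̃`-equivalent to `ω`, that is,
`g̃(ξ, u) = ω(u)` for all `u` (existing and unique as `g̃` is positive definite). -/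
def riggedField (F : Type*) [NormedAddCommGroup F]
    [NormedSpace ℝ F] {L : Type*} [TopologicalSpace L] [ChartedSpace F L]
    (g : BilinField E M) (i : L → M) (ζ : VField E M) : VField F L := fun p =>
  Classical.epsilon fun v : TangentSpace 𝓘(ℝ, F) p =>
    ∀ u, riggedMetric F g i ζ p v u = riggedForm F g i ζ p u

end Hypersurface

end RiggedNull

end

open RiggedNull

noncomputable section

namespace RiggedNull

/-! Write `k` for `i^*g`, `h` for the rigged metric `k + ω ⊗ ω`, and `b = ω([X, Y])`. A null
direction of `k`, normalised by `ω = 1`, represents `ω` for `h`, so it is `ξ`; hence `ξ` is an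
`h`-unit field spanning the radical of `k`. Since `k` is nonnegative with radical spanned by `ξ`,
`h` is positive definite.

The flow is Riemannian (`isRiemannianFlow`) because `L` is totally geodesic: `∇_A B` is tangent to
`L`, hence `g`-orthogonal to the null field `V`. In Koszul terms this says that `V` has vanishing
`k`-derivatives, so `L_V k = 0`, and `h = k` on the screen.

Both curvature equalities come from one expression of `h(R(X, Y)Y, X)` (`apply_curvature`):
derivatives of Koszul functions, products of first covariant derivatives, and a Koszul term for `[X,
Y]`. Because the flow is Riemannian, `h(∇_X Y, ξ) = b / 2` for screen sections
(`apply_leviCivita_field`).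

Passing from the connection of `h` to the transverse one (`transverseSectionalCurvature_eq`), or to
that of `g` (`apply_curvature_eq`), causes the same two corrections. Dropping the `ξ`-components
from the product of `∇_X Y` and `∇_Y X` contributes `b² / 4`; the `ξ`-component of `[X, Y]`
contributes `b² / 2`. Finally `dω(X, Y) = -b` on the screen.

For the ambient side, Koszul expressions of `i`-related fields agree (`koszul_pullbackForm`), and
those of `h` and `k` differ by one explicit bracket term (`koszul_riggedMetric`). Tensoriality of
curvature (`curvature_congr`) permits replacing arbitrary ambient fields by `i`-related ones. -/

theorem natCast_le_infty (n : ℕ) : (n : WithTop ℕ∞) ≤ ∞ := by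
  exact_mod_cast le_top

/-! ### Directional derivatives, Lie brackets and smoothness of vector fields. -/

section Calculus

variable {E : Type*} [NormedAddCommGroup E] [NormedSpace ℝ E]
  {M : Type*} [TopologicalSpace M] [ChartedSpace E M]

/-- The function `f` is smooth at `p`. -/
abbrev SmoothFnAt (f : M → ℝ) (p : M) : Prop := ContMDiffAt 𝓘(ℝ, E) 𝓘(ℝ, ℝ) ∞ f p

/-- The function `f` is differentiable at `p`. -/
abbrev DiffFnAt (f : M → ℝ) (p : M) : Prop := MDifferentiableAt 𝓘(ℝ, E) 𝓘(ℝ, ℝ) f p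

theorem SmoothFnAt.diff {f : M → ℝ} {p : M} (hf : SmoothFnAt (E := E) f p) :
    DiffFnAt (E := E) f p :=
  ContMDiffAt.mdifferentiableAt hf (by simp)

theorem SmoothFnAt.eventually_diff [IsManifold 𝓘(ℝ, E) ∞ M] {f : M → ℝ} {p : M}
    (hf : SmoothFnAt (E := E) f p) : ∀ᶠ q in 𝓝 p, DiffFnAt (E := E) f q := by
  have := IsManifold.of_le (I := 𝓘(ℝ, E)) (M := M) (m := 1) (n := ∞) (by simp)
  have h1 : ContMDiffAt 𝓘(ℝ, E) 𝓘(ℝ, ℝ) 1 f p := hf.of_le (by simp)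
  filter_upwards [(contMDiffAt_iff_contMDiffAt_nhds (by simp)).1 h1] with q hq
    using hq.mdifferentiableAt (by simp)

section dirDeriv

variable {X X' : VField E M} {f f' : M → ℝ} {p : M}

theorem dirDeriv_add (hf : DiffFnAt (E := E) f p) (hf' : DiffFnAt (E := E) f' p) :
    dirDeriv X (fun q => f q + f' q) p = dirDeriv X f p + dirDeriv X f' p := by
  have := mvfderiv_add hf hf'
  exact congrArg (fun l => l (X p)) this

theorem dirDeriv_mul (hf : DiffFnAt (E := E) f p) (hf' : DiffFnAt (E := E) f' p) :
    dirDeriv X (fun q => f q * f' q) p = f p * dirDeriv X f' p + f' p * dirDeriv X f p := by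
  have := mvfderiv_mul hf hf'
  have := congrArg (fun l => l (X p)) this
  simpa [dirDeriv] using! this

theorem dirDeriv_congr (h : f =ᶠ[𝓝 p] f') : dirDeriv X f p = dirDeriv X f' p := by
  have h1 : mfderiv 𝓘(ℝ, E) 𝓘(ℝ, ℝ) f p = mfderiv 𝓘(ℝ, E) 𝓘(ℝ, ℝ) f' p := h.mfderiv_eq
  exact congrArg (fun l : E →L[ℝ] ℝ => l (X p)) h1

theorem dirDeriv_const (c : ℝ) : dirDeriv X (fun _ => c) p = 0 := by
  simp [dirDeriv, mvfderiv_const]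

theorem dirDeriv_eq_zero {c : ℝ} (h : ∀ᶠ q in 𝓝 p, f q = c) : dirDeriv X f p = 0 :=
  (dirDeriv_congr (f' := fun _ => c) h).trans (dirDeriv_const c)

theorem dirDeriv_add_field : dirDeriv (X + X') f p = dirDeriv X f p + dirDeriv X' f p :=
  map_add (mvfderiv 𝓘(ℝ, E) f p) (X p) (X' p)

theorem dirDeriv_smul_field : dirDeriv (f' • X) f p = f' p * dirDeriv X f p :=
  map_smul (mvfderiv 𝓘(ℝ, E) f p) (f' p) (X p)

theorem dirDeriv_congr_field (h : X p = X' p) : dirDeriv X f p = dirDeriv X' f p := by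
  simp [dirDeriv, h]

end dirDeriv

section bracket

variable {X X' Y Y' : VField E M} {p : M}

theorem bracket_swap (X Y : VField E M) (p : M) : bracket X Y p = -bracket Y X p :=
  VectorField.mlieBracket_swap_apply

theorem bracket_congr (hX : X =ᶠ[𝓝 p] X') (hY : Y =ᶠ[𝓝 p] Y') :
    bracket X Y p = bracket X' Y' p :=
  hX.mlieBracket_vectorField_eq hY

theorem bracket_zero_left (Y : VField E M) (p : M) : bracket 0 Y p = 0 := by
  simp [bracket, VectorField.mlieBracket_zero_left]

end bracket

variable [IsManifold 𝓘(ℝ, E) ∞ M]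

/-- The vector field `X` is differentiable at `p`. -/
abbrev DiffAt (X : VField E M) (p : M) : Prop :=
  MDifferentiableAt 𝓘(ℝ, E) 𝓘(ℝ, E).tangent (fun q => (⟨q, X q⟩ : TangentBundle 𝓘(ℝ, E) M)) p

/-- The bracket and regularity lemmas ask for a manifold structure at specific finite orders; these
weakenings of the `C^∞` structure serve as local instances. -/
theorem isManifold_one : IsManifold 𝓘(ℝ, E) 1 M :=
  IsManifold.of_le (n := ∞) (by simp)

theorem isManifold_two : IsManifold 𝓘(ℝ, E) 2 M :=
  IsManifold.of_le (n := ∞) (natCast_le_infty 2)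

theorem isManifold_three : IsManifold 𝓘(ℝ, E) 3 M :=
  IsManifold.of_le (n := ∞) (natCast_le_infty 3)

theorem isManifold_minSmoothness_two : IsManifold 𝓘(ℝ, E) (minSmoothness ℝ 2) M := by
  simpa using isManifold_two

theorem isManifold_minSmoothness_three : IsManifold 𝓘(ℝ, E) (minSmoothness ℝ 3) M := by
  simpa using isManifold_three

theorem isManifold_top_add_one : IsManifold 𝓘(ℝ, E) ((∞ : WithTop ℕ∞) + 1) M := by
  simpa

attribute [local instance] isManifold_one isManifold_two isManifold_minSmoothness_two
  isManifold_minSmoothness_three isManifold_top_add_one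

variable {X X' Y Y' Z : VField E M} {f f' : M → ℝ} {p : M}

theorem SmoothAt.diff (h : SmoothAt X p) : DiffAt X p :=
  ContMDiffAt.mdifferentiableAt h (by simp)

/-- Smoothness at `p` gives, for each finite order, a neighbourhood that may depend on the order.
Facts needed at nearby points are therefore stated with `C^2` or differentiability hypotheses. -/
theorem SmoothAt.eventually_contMDiffAt (h : SmoothAt X p) (n : ℕ) :
    ∀ᶠ q in 𝓝 p, ContMDiffAt 𝓘(ℝ, E) 𝓘(ℝ, E).tangent n
      (fun q => (⟨q, X q⟩ : TangentBundle 𝓘(ℝ, E) M)) q := by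
  have := IsManifold.of_le (I := 𝓘(ℝ, E)) (M := M) (m := (n : WithTop ℕ∞) + 1) (n := ∞)
    (by exact_mod_cast le_top)
  have := IsManifold.of_le (I := 𝓘(ℝ, E)) (M := M) (m := (n : WithTop ℕ∞)) (n := ∞)
    (by exact_mod_cast le_top)
  have h1 : ContMDiffAt 𝓘(ℝ, E) 𝓘(ℝ, E).tangent n
      (fun q => (⟨q, X q⟩ : TangentBundle 𝓘(ℝ, E) M)) p :=
    ContMDiffAt.of_le h (by exact_mod_cast le_top)
  exact (contMDiffAt_iff_contMDiffAt_nhds (by simp)).1 h1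

theorem SmoothAt.eventually_diff (h : SmoothAt X p) : ∀ᶠ q in 𝓝 p, DiffAt X q := by
  filter_upwards [h.eventually_contMDiffAt 1] with q hq using hq.mdifferentiableAt (by simp)

theorem SmoothAt.congr (h : SmoothAt X p) (hX : X' =ᶠ[𝓝 p] X) : SmoothAt X' p :=
  ContMDiffAt.congr_of_eventuallyEq h (hX.mono fun q hq => by simp only [hq])

theorem DiffAt.congr (h : DiffAt X p) (hX : X' =ᶠ[𝓝 p] X) : DiffAt X' p :=
  MDifferentiableAt.congr_of_eventuallyEq h (hX.mono fun q hq => by simp only [hq])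

theorem SmoothAt.add (h : SmoothAt X p) (h' : SmoothAt X' p) : SmoothAt (X + X') p :=
  ContMDiffAt.add_section h h'

theorem SmoothAt.sub (h : SmoothAt X p) (h' : SmoothAt X' p) : SmoothAt (X - X') p :=
  ContMDiffAt.sub_section h h'

theorem SmoothAt.smul (hf : SmoothFnAt (E := E) f p) (h : SmoothAt X p) : SmoothAt (f • X) p :=
  ContMDiffAt.smul_section hf h

theorem DiffAt.add (h : DiffAt X p) (h' : DiffAt X' p) : DiffAt (X + X') p :=
  mdifferentiableAt_add_section h h'

theorem DiffAt.smul (hf : DiffFnAt (E := E) f p) (h : DiffAt X p) : DiffAt (f • X) p :=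
  MDifferentiableAt.smul_section hf h

theorem smoothAt_extend (v : TangentSpace 𝓘(ℝ, E) p) : SmoothAt (FiberBundle.extend E v) p :=
  FiberBundle.contMDiffAt_extend 𝓘(ℝ, E) E v

theorem extend_self (v : TangentSpace 𝓘(ℝ, E) p) :
    (FiberBundle.extend E v : VField E M) p = v :=
  FiberBundle.extend_apply_self (F := E) v

section bracket

variable [CompleteSpace E]

theorem bracket_smul_right (hf : DiffFnAt (E := E) f p) (hY : DiffAt Y p) :
    bracket X (f • Y) p = dirDeriv X f p • Y p + f p • bracket X Y p :=
  VectorField.mlieBracket_smul_right hf hY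

theorem bracket_smul_left (hf : DiffFnAt (E := E) f p) (hX : DiffAt X p) :
    bracket (f • X) Y p = -dirDeriv Y f p • X p + f p • bracket X Y p :=
  VectorField.mlieBracket_smul_left hf hX

theorem bracket_add_right (hY : DiffAt Y p) (hY' : DiffAt Y' p) :
    bracket X (Y + Y') p = bracket X Y p + bracket X Y' p :=
  VectorField.mlieBracket_add_right hY hY'

theorem bracket_add_left (hX : DiffAt X p) (hX' : DiffAt X' p) :
    bracket (X + X') Y p = bracket X Y p + bracket X' Y p :=
  VectorField.mlieBracket_add_left hX hX'

theorem SmoothAt.bracket (hX : SmoothAt X p) (hY : SmoothAt Y p) : SmoothAt (bracket X Y) p :=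
  ContMDiffAt.mlieBracket_vectorField (m := ⊤) (n := ⊤) hX hY (by simp)

end bracket

theorem contMDiffAt_dirDeriv {n m : WithTop ℕ∞} [IsManifold 𝓘(ℝ, E) n M]
    (hf : ContMDiffAt 𝓘(ℝ, E) 𝓘(ℝ, ℝ) n f p)
    (hX : ContMDiffAt 𝓘(ℝ, E) 𝓘(ℝ, E).tangent m
      (fun q => (⟨q, X q⟩ : TangentBundle 𝓘(ℝ, E) M)) p) (hmn : m + 1 ≤ n) (hm : m ≤ n) :
    ContMDiffAt 𝓘(ℝ, E) 𝓘(ℝ, ℝ) m (dirDeriv X f) p := by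
  have h := ContMDiffAt.clm_apply_of_inCoordinates (hf.mfderiv_const hmn) hX (hf.of_le hm)
  simpa [dirDeriv, mvfderiv] using! (contMDiffAt_totalSpace.1 h).2

theorem SmoothAt.sum {ι : Type*} {s : Finset ι} {X : ι → VField E M} {p : M}
    (h : ∀ a ∈ s, SmoothAt (X a) p) : SmoothAt (fun q => ∑ a ∈ s, X a q) p :=
  ContMDiffAt.sum_section h

theorem SmoothFnAt.dirDeriv {X : VField E M} {f : M → ℝ} {p : M} (hX : SmoothAt X p)
    (hf : SmoothFnAt (E := E) f p) : SmoothFnAt (E := E) (dirDeriv X f) p :=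
  contMDiffAt_dirDeriv hf hX (by simp) le_rfl

end Calculus

/-! ### Local frames, tensoriality, and the bracket as a commutator. -/

section Frames

attribute [local instance] isManifold_one isManifold_two isManifold_minSmoothness_two
  isManifold_minSmoothness_three isManifold_top_add_one

variable {E : Type*} [NormedAddCommGroup E] [NormedSpace ℝ E] [FiniteDimensional ℝ E]
  {M : Type*} [TopologicalSpace M] [ChartedSpace E M] [IsManifold 𝓘(ℝ, E) ∞ M]

/-- A smooth local frame at `p`, together with the coefficients of tangent vectors in it. -/
structure LocalFrame (E : Type*) [NormedAddCommGroup E] [NormedSpace ℝ E]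
    {M : Type*} [TopologicalSpace M] [ChartedSpace E M] [IsManifold 𝓘(ℝ, E) ∞ M] (p : M) where
  /-- The number of frame fields. -/
  rank : ℕ
  /-- The frame fields. -/
  field : Fin rank → VField E M
  /-- The coefficients of a tangent vector. -/
  coeff : Fin rank → (q : M) → TangentSpace 𝓘(ℝ, E) q →ₗ[ℝ] ℝ
  smooth_field : ∀ a, SmoothAt (field a) p
  smooth_coeff : ∀ a (X : VField E M), SmoothAt X p →
    SmoothFnAt (E := E) (fun q => coeff a q (X q)) p
  diff_coeff : ∀ a (X : VField E M), DiffAt X p → DiffFnAt (E := E) (fun q => coeff a q (X q)) p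
  coeff_field : ∀ a b, coeff a p (field b p) = if b = a then 1 else 0
  expand : ∀ᶠ q in 𝓝 p, ∀ v, v = ∑ a, coeff a q v • field a q

/-- The local frame given by the preferred chart at `p`. -/
def localFrame (p : M) : LocalFrame E p :=
  have hp := FiberBundle.mem_baseSet_trivializationAt E (TangentSpace 𝓘(ℝ, E)) p
  { rank := Module.finrank ℝ E
    field := (trivializationAt E (TangentSpace 𝓘(ℝ, E)) p).localFrame (Module.finBasis ℝ E)
    coeff := (trivializationAt E (TangentSpace 𝓘(ℝ, E)) p).localFrameCoeff 𝓘(ℝ, E)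
      (Module.finBasis ℝ E)
    smooth_field := fun a => contMDiffAt_localFrame_of_mem ∞ _ _ a hp
    smooth_coeff := fun a X hX => contMDiffAt_localFrameCoeff _ hp hX a
    diff_coeff := fun a X hX => mdifferentiableAt_localFrameCoeff _ hp hX a
    coeff_field := fun a b => by
      rw [Trivialization.localFrameCoeff_apply_of_mem_baseSet _ _ hp,
        Trivialization.localFrame_apply_of_mem_baseSet _ _ hp, Module.Basis.repr_self,
        Finsupp.single_apply]
    expand := by
      filter_upwards [(trivializationAt E (TangentSpace 𝓘(ℝ, E)) p).open_baseSet.mem_nhds hp]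
        with q hq v
      have := (trivializationAt E (TangentSpace 𝓘(ℝ, E)) p).eq_sum_localFrameCoeff_smul
        (I := 𝓘(ℝ, E)) (b := Module.finBasis ℝ E) (s := FiberBundle.extend E v) hq
      simpa only [extend_self] using this }

/-- A map on vector fields which is additive and homogeneous over germs of smooth functions
depends only on the value at `p`. -/
theorem eq_of_smooth_tensorial {A : Type*} [AddCommGroup A] [Module ℝ A] {p : M}
    {Φ : VField E M → A}
    (hadd : ∀ X X', SmoothAt X p → SmoothAt X' p → Φ (X + X') = Φ X + Φ X')
    (hsmul : ∀ (f : M → ℝ) X, SmoothFnAt (E := E) f p → SmoothAt X p → Φ (f • X) = f p • Φ X)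
    {X X' : VField E M} (hX : SmoothAt X p) (hX' : SmoothAt X' p) (h : X p = X' p) :
    Φ X = Φ X' := by
  classical
  have hlocal : ∀ {Y Y' : VField E M}, SmoothAt Y p → SmoothAt Y' p → Y =ᶠ[𝓝 p] Y' →
      Φ Y = Φ Y' := by
    intro Y Y' hY hY' hYY'
    -- This indicator function is constantly `1` near `p`, hence smooth there, while `ψ • Y` and `ψ
    -- • Y'` agree everywhere: homogeneity alone gives locality, without bump functions.
    let ψ : M → ℝ := fun q => if Y q = Y' q then 1 else 0
    have hψp : ψ p = 1 := by simp [ψ, hYY'.eq_of_nhds]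
    have hψ : SmoothFnAt (E := E) ψ p :=
      (contMDiffAt_const (c := (1 : ℝ))).congr_of_eventuallyEq
        (hYY'.mono fun q hq => by simp [ψ, hq])
    have heq : ψ • Y = ψ • Y' := by
      funext q
      by_cases hq : Y q = Y' q <;> simp [ψ, hq]
    have h1 := hsmul ψ Y hψ hY
    have h2 := hsmul ψ Y' hψ hY'
    rw [hψp, one_smul] at h1 h2
    rw [← h1, ← h2, heq]
  have h0 : Φ 0 = 0 := by
    have := hsmul 0 0 contMDiffAt_const (contMDiff_zeroSection ℝ _ p)
    simpa using this
  have hsum : ∀ (ι : Type) (s : Finset ι) (Y : ι → VField E M), (∀ a, SmoothAt (Y a) p) →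
      Φ (fun q => ∑ a ∈ s, Y a q) = ∑ a ∈ s, Φ (Y a) := by
    intro ι s Y hY
    induction s using Finset.induction_on with
    | empty => simpa using! h0
    | insert a s ha ih =>
      rw [Finset.sum_insert ha, ← ih, ← hadd _ _ (hY a) (SmoothAt.sum fun b _ => hY b)]
      congr 1
      funext q
      simp [Finset.sum_insert ha]
  let e := localFrame (E := E) p
  have hexp : ∀ {Y : VField E M}, SmoothAt Y p →
      Φ Y = ∑ a, e.coeff a p (Y p) • Φ (e.field a) := by
    intro Y hY
    have hs : ∀ a, SmoothAt ((fun q => e.coeff a q (Y q)) • e.field a) p := fun a =>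
      SmoothAt.smul (e.smooth_coeff a Y hY) (e.smooth_field a)
    rw [hlocal hY (SmoothAt.sum fun a _ => hs a) (e.expand.mono fun q hq => hq (Y q)),
      hsum _ _ _ hs]
    exact Finset.sum_congr rfl fun a _ => hsmul _ _ (e.smooth_coeff a Y hY) (e.smooth_field a)
  rw [hexp hX, hexp hX', h]

/-- The Lie bracket is the commutator of derivations. -/
theorem dirDeriv_bracket {X Y : VField E M} {f : M → ℝ} {p : M}
    (hX : ContMDiffAt 𝓘(ℝ, E) 𝓘(ℝ, E).tangent 2
      (fun q => (⟨q, X q⟩ : TangentBundle 𝓘(ℝ, E) M)) p)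
    (hY : ContMDiffAt 𝓘(ℝ, E) 𝓘(ℝ, E).tangent 2
      (fun q => (⟨q, Y q⟩ : TangentBundle 𝓘(ℝ, E) M)) p)
    (hf : ContMDiffAt 𝓘(ℝ, E) 𝓘(ℝ, ℝ) 2 f p) :
    dirDeriv (bracket X Y) f p = dirDeriv X (dirDeriv Y f) p - dirDeriv Y (dirDeriv X f) p := by
  rcases subsingleton_or_nontrivial E with hE | hE
  · have : ∀ (Z : VField E M) (h : M → ℝ), RiggedNull.dirDeriv Z h p = 0 := fun Z h => by
      have : Z p = 0 := Subsingleton.elim (α := E) _ _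
      simp [RiggedNull.dirDeriv, this]
    simp [this]
  obtain ⟨v, hv⟩ := exists_ne (0 : E)
  -- The commutator identity is extracted from the Jacobi identity: apply it to `f • Z` and to `Z`,
  -- subtract, and read off the coefficient of the nonzero vector `Z p`.
  let Z : VField E M := FiberBundle.extend E (x := p) (E := TangentSpace 𝓘(ℝ, E)) v
  have hZ : SmoothAt Z p := smoothAt_extend (p := p) v
  have hZp : Z p = v := extend_self (p := p) v
  have h12 : (1 : WithTop ℕ∞) ≤ 2 := by norm_num
  have h112 : (1 : WithTop ℕ∞) + 1 ≤ 2 := by norm_num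
  have hX1 := hX.of_le h12
  have hY1 := hY.of_le h12
  have hf1 := hf.of_le h12
  have hZ2 : ContMDiffAt 𝓘(ℝ, E) 𝓘(ℝ, E).tangent 2
      (fun q => (⟨q, Z q⟩ : TangentBundle 𝓘(ℝ, E) M)) p :=
    ContMDiffAt.of_le hZ (natCast_le_infty 2)
  have hZd : ∀ᶠ q in 𝓝 p, DiffAt Z q := hZ.eventually_diff
  have hfd : ∀ᶠ q in 𝓝 p, DiffFnAt (E := E) f q := by
    filter_upwards [(contMDiffAt_iff_contMDiffAt_nhds (by simp)).1 hf1] with q hq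
      using hq.mdifferentiableAt (by simp)
  have : IsManifold 𝓘(ℝ, E) (((2 : ℕ∞) : WithTop ℕ∞) + 1) M :=
    IsManifold.of_le (n := ∞) (natCast_le_infty 3)
  have hbr : ∀ {U : VField E M}, ContMDiffAt 𝓘(ℝ, E) 𝓘(ℝ, E).tangent 2
      (fun q => (⟨q, U q⟩ : TangentBundle 𝓘(ℝ, E) M)) p → DiffAt (bracket U Z) p := by
    intro U hU
    exact (ContMDiffAt.mlieBracket_vectorField (m := 1) (n := 2) hU hZ2
      (by simp; norm_num)).mdifferentiableAt (by simp)
  have hdd : ∀ {U : VField E M}, ContMDiffAt 𝓘(ℝ, E) 𝓘(ℝ, E).tangent 1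
      (fun q => (⟨q, U q⟩ : TangentBundle 𝓘(ℝ, E) M)) p →
      DiffFnAt (E := E) (RiggedNull.dirDeriv U f) p := fun hU =>
    (contMDiffAt_dirDeriv hf hU h112 h12).mdifferentiableAt (by simp)
  have key : ∀ {U : VField E M}, bracket U (f • Z) =ᶠ[𝓝 p]
      RiggedNull.dirDeriv U f • Z + f • bracket U Z := by
    intro U
    filter_upwards [hZd, hfd] with q hq hq' using bracket_smul_right hq' hq
  have hdf := hfd.self_of_nhds
  have expand : ∀ {U V : VField E M}, ContMDiffAt 𝓘(ℝ, E) 𝓘(ℝ, E).tangent 2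
      (fun q => (⟨q, V q⟩ : TangentBundle 𝓘(ℝ, E) M)) p →
      bracket U (bracket V (f • Z)) p
      = RiggedNull.dirDeriv U (RiggedNull.dirDeriv V f) p • Z p
        + RiggedNull.dirDeriv V f p • bracket U Z p
        + (RiggedNull.dirDeriv U f p • bracket V Z p + f p • bracket U (bracket V Z) p) := by
    intro U V hV
    have hV1 := hV.of_le h12
    rw [bracket_congr (Filter.EventuallyEq.refl _ U) key,
      bracket_add_right ((hdd hV1).smul_section hZ.diff) (hdf.smul_section (hbr hV)),
      bracket_smul_right (hdd hV1) hZ.diff, bracket_smul_right hdf (hbr hV)]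
  have hJ := VectorField.leibniz_identity_mlieBracket_apply (I := 𝓘(ℝ, E)) (U := X) (V := Y)
    (W := f • Z) (x := p) (by simpa using hX) (by simpa using hY)
    (by simpa using ContMDiffAt.smul_section hf hZ2)
  have hJ' := VectorField.leibniz_identity_mlieBracket_apply (I := 𝓘(ℝ, E)) (U := X) (V := Y)
    (W := Z) (x := p) (by simpa using hX) (by simpa using hY) (by simpa using hZ2)
  change bracket X (bracket Y (f • Z)) p
    = bracket (bracket X Y) (f • Z) p + bracket Y (bracket X (f • Z)) p at hJ
  change bracket X (bracket Y Z) p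
    = bracket (bracket X Y) Z p + bracket Y (bracket X Z) p at hJ'
  rw [expand hY, expand hX, bracket_smul_right hdf hZ.diff, hJ'] at hJ
  have h0 : (RiggedNull.dirDeriv (bracket X Y) f p - (RiggedNull.dirDeriv X (RiggedNull.dirDeriv Y f) p
      - RiggedNull.dirDeriv Y (RiggedNull.dirDeriv X f) p)) • Z p = 0 := by
    rw [← sub_eq_zero] at hJ
    rw [← neg_eq_zero, ← hJ]
    module
  rw [smul_eq_zero, or_iff_left (by rw [hZp]; exact hv)] at h0
  linarith

end Frames

/-! ### Koszul calculus and the Levi-Civita derivative. -/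

section Forms

attribute [local instance] isManifold_one isManifold_two isManifold_minSmoothness_two
  isManifold_minSmoothness_three isManifold_top_add_one

variable {E : Type*} [NormedAddCommGroup E] [NormedSpace ℝ E]
  {M : Type*} [TopologicalSpace M] [ChartedSpace E M]

theorem koszul_congr {h : BilinField E M} {X X' Y Y' Z : VField E M} {p : M}
    (hX : X =ᶠ[𝓝 p] X') (hY : Y =ᶠ[𝓝 p] Y') :
    koszul h X Y Z p = koszul h X' Y' Z p := by
  have e : Z =ᶠ[𝓝 p] Z := Filter.EventuallyEq.refl _ _
  unfold koszul
  rw [dirDeriv_congr_field hX.eq_of_nhds, dirDeriv_congr_field hY.eq_of_nhds,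
    dirDeriv_congr (f := fun q => h q (Y q) (Z q)) (f' := fun q => h q (Y' q) (Z q))
      (hY.mono fun q hq => by simp only [hq]),
    dirDeriv_congr (f := fun q => h q (Z q) (X q)) (f' := fun q => h q (Z q) (X' q))
      (hX.mono fun q hq => by simp only [hq]),
    dirDeriv_congr (f := fun q => h q (X q) (Y q)) (f' := fun q => h q (X' q) (Y' q))
      ((hX.and hY).mono fun q hq => by simp only [hq.1, hq.2]),
    bracket_congr hX hY, bracket_congr hY e, bracket_congr e hX, hX.eq_of_nhds, hY.eq_of_nhds]

variable [IsManifold 𝓘(ℝ, E) ∞ M]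

/-- A smooth field of symmetric bilinear forms. -/
structure IsSmoothForm (h : BilinField E M) : Prop where
  symm : ∀ p u v, h p u v = h p v u
  smooth : ∀ (p : M) (X Y : VField E M), SmoothAt X p → SmoothAt Y p →
    SmoothFnAt (E := E) (fun q => h q (X q) (Y q)) p

/-- A pseudo-Riemannian metric. -/
structure IsPseudoMetric (h : BilinField E M) : Prop extends IsSmoothForm h where
  nondegenerate : ∀ p u, (∀ v, h p u v = 0) → u = 0

variable {h : BilinField E M} {X X' Y Y' Z : VField E M} {f : M → ℝ} {p : M}

/-- Torsion-freeness at the level of the Koszul expression. Like metric compatibility in the next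
lemma, it needs only symmetry, so it applies to the degenerate form `i^*g`. -/
theorem IsSmoothForm.koszul_sub_koszul_swap (hh : IsSmoothForm h) (X Y Z : VField E M) (p : M) :
    koszul h X Y Z p - koszul h Y X Z p = h p (bracket X Y p) (Z p) := by
  simp only [koszul]
  rw [bracket_swap Y X, bracket_swap X Z, bracket_swap Z Y]
  simp only [hh.symm _ (X _) (Z _), hh.symm _ (Y _) (Z _), hh.symm _ (Y _) (X _), map_neg,
    neg_apply]
  ring

theorem IsSmoothForm.koszul_add_koszul (hh : IsSmoothForm h) (X Y Z : VField E M) (p : M) :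
    koszul h X Y Z p + koszul h X Z Y p = dirDeriv X (fun q => h q (Y q) (Z q)) p := by
  simp only [koszul]
  rw [bracket_swap X Z, bracket_swap Y X, bracket_swap Z Y]
  simp only [hh.symm _ (X _) (Z _), hh.symm _ (Z _) (Y _), hh.symm _ (Y _) (X _), map_neg,
    neg_apply]
  ring

theorem IsPseudoMetric.eq_of_apply_eq (hh : IsPseudoMetric h) {u v : TangentSpace 𝓘(ℝ, E) p}
    (huv : ∀ w, h p u w = h p v w) : u = v := by
  rw [← sub_eq_zero]
  refine hh.nondegenerate p _ fun w => ?_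
  rw [map_sub, sub_apply, huv, sub_self]

variable [FiniteDimensional ℝ E]

/-- Smoothness of a form is tested on smooth fields only, whereas `leviCivita` is tested against
differentiable ones; expansion in a smooth frame bridges the two. -/
theorem IsSmoothForm.diff (hh : IsSmoothForm h) (hX : DiffAt X p) (hY : DiffAt Y p) :
    DiffFnAt (E := E) (fun q => h q (X q) (Y q)) p := by
  let e := localFrame (E := E) p
  have : (fun q => h q (X q) (Y q)) =ᶠ[𝓝 p] ∑ a, ∑ b,
      (fun q => (e.coeff a q (X q) * e.coeff b q (Y q)) * h q (e.field a q) (e.field b q)) := by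
    filter_upwards [e.expand] with q hq
    conv_lhs => rw [hq (X q), hq (Y q)]
    simp only [map_sum, map_smul, sum_apply, smul_apply,
      Finset.sum_apply, smul_eq_mul, Finset.mul_sum]
    rw [Finset.sum_comm]
    refine Finset.sum_congr rfl fun a _ => Finset.sum_congr rfl fun b _ => by ring
  refine MDifferentiableAt.congr_of_eventuallyEq ?_ this
  refine MDifferentiableAt.sum fun a _ => MDifferentiableAt.sum fun b _ => ?_
  exact ((e.diff_coeff a X hX).mul (e.diff_coeff b Y hY)).mul
    (SmoothFnAt.diff (hh.smooth p _ _ (e.smooth_field a) (e.smooth_field b)))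

theorem IsSmoothForm.koszul_smul_right (hh : IsSmoothForm h) (hX : DiffAt X p) (hY : DiffAt Y p)
    (hf : DiffFnAt (E := E) f p) (hZ : DiffAt Z p) :
    koszul h X Y (f • Z) p = f p * koszul h X Y Z p := by
  simp only [koszul, Pi.smul_apply', map_smul, smul_apply, smul_eq_mul]
  rw [dirDeriv_mul hf (hh.diff hY hZ), dirDeriv_mul hf (hh.diff hZ hX), bracket_smul_right hf hZ,
    bracket_smul_left hf hZ, dirDeriv_smul_field]
  simp only [map_smul, smul_apply, smul_eq_mul, map_add,
    add_apply, hh.symm p (Y p) (Z p)]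
  ring

theorem IsSmoothForm.koszul_add_right (hh : IsSmoothForm h) (hX : DiffAt X p) (hY : DiffAt Y p)
    {Z' : VField E M} (hZ : DiffAt Z p) (hZ' : DiffAt Z' p) :
    koszul h X Y (Z + Z') p = koszul h X Y Z p + koszul h X Y Z' p := by
  simp only [koszul, Pi.add_apply, map_add, add_apply]
  rw [dirDeriv_add (hh.diff hY hZ) (hh.diff hY hZ'), dirDeriv_add (hh.diff hZ hX) (hh.diff hZ' hX),
    bracket_add_right hZ hZ', bracket_add_left hZ hZ', dirDeriv_add_field]
  simp only [map_add, add_apply]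
  ring

theorem IsSmoothForm.tensorialAt_koszul (hh : IsSmoothForm h) (hX : DiffAt X p)
    (hY : DiffAt Y p) : TensorialAt 𝓘(ℝ, E) E (fun Z : VField E M => koszul h X Y Z p) p where
  smul hf hZ := hh.koszul_smul_right hX hY hf hZ
  add hZ hZ' := hh.koszul_add_right hX hY hZ hZ'

theorem IsSmoothForm.koszul_smul_left (hh : IsSmoothForm h) (hX : DiffAt X p) (hY : DiffAt Y p)
    (hf : DiffFnAt (E := E) f p) (hZ : DiffAt Z p) :
    koszul h (f • X) Y Z p = f p * koszul h X Y Z p := by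
  simp only [koszul, Pi.smul_apply', map_smul, smul_apply, smul_eq_mul]
  rw [dirDeriv_mul hf (hh.diff hX hY), dirDeriv_mul hf (hh.diff hZ hX), bracket_smul_right hf hX,
    bracket_smul_left hf hX, dirDeriv_smul_field]
  simp only [map_smul, smul_apply, smul_eq_mul, map_add, add_apply, hh.symm p (X p) (Z p)]
  ring

theorem IsSmoothForm.koszul_add_left (hh : IsSmoothForm h) (hX : DiffAt X p) (hX' : DiffAt X' p)
    (hY : DiffAt Y p) (hZ : DiffAt Z p) :
    koszul h (X + X') Y Z p = koszul h X Y Z p + koszul h X' Y Z p := by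
  simp only [koszul, Pi.add_apply, map_add, add_apply]
  rw [dirDeriv_add (hh.diff hX hY) (hh.diff hX' hY), dirDeriv_add (hh.diff hZ hX) (hh.diff hZ hX'),
    bracket_add_right hX hX', bracket_add_left hX hX', dirDeriv_add_field]
  simp only [map_add, add_apply]
  ring

theorem IsSmoothForm.tensorialAt_koszul_left (hh : IsSmoothForm h) (hY : DiffAt Y p)
    (hZ : DiffAt Z p) : TensorialAt 𝓘(ℝ, E) E (fun X : VField E M => koszul h X Y Z p) p where
  smul hf hX := hh.koszul_smul_left hX hY hf hZ
  add hX hX' := hh.koszul_add_left hX hX' hY hZ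

/-- The Leibniz rule follows from linearity in the first slot by exchanging the first two arguments,
at the cost of a bracket. -/
theorem IsSmoothForm.koszul_smul_middle (hh : IsSmoothForm h) (hX : DiffAt X p) (hY : DiffAt Y p)
    (hf : DiffFnAt (E := E) f p) (hZ : DiffAt Z p) :
    koszul h X (f • Y) Z p = f p * koszul h X Y Z p + dirDeriv X f p * h p (Y p) (Z p) := by
  have h1 := hh.koszul_sub_koszul_swap X (f • Y) Z p
  have h2 := hh.koszul_sub_koszul_swap X Y Z p
  rw [bracket_smul_right hf hY, hh.koszul_smul_left hY hX hf hZ] at h1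
  simp only [map_add, map_smul, add_apply, smul_apply, smul_eq_mul] at h1
  linear_combination h1 - f p * h2

theorem IsSmoothForm.koszul_add_middle (hh : IsSmoothForm h) (hX : DiffAt X p) (hY : DiffAt Y p)
    (hY' : DiffAt Y' p) (hZ : DiffAt Z p) :
    koszul h X (Y + Y') Z p = koszul h X Y Z p + koszul h X Y' Z p := by
  have h1 := hh.koszul_sub_koszul_swap X (Y + Y') Z p
  have h2 := hh.koszul_sub_koszul_swap X Y Z p
  have h3 := hh.koszul_sub_koszul_swap X Y' Z p
  rw [bracket_add_right hY hY', hh.koszul_add_left hY hY' hX hZ] at h1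
  simp only [map_add, add_apply] at h1
  linear_combination h1 - h2 - h3

theorem IsSmoothForm.smooth_koszul (hh : IsSmoothForm h) (hX : SmoothAt X p) (hY : SmoothAt Y p)
    (hZ : SmoothAt Z p) : SmoothFnAt (E := E) (koszul h X Y Z) p := by
  have hc : SmoothFnAt (E := E) (fun _ : M => (1 / 2 : ℝ)) p := contMDiffAt_const
  exact hc.mul ((((((SmoothFnAt.dirDeriv hX (hh.smooth _ _ _ hY hZ)).add
    (SmoothFnAt.dirDeriv hY (hh.smooth _ _ _ hZ hX))).sub
    (SmoothFnAt.dirDeriv hZ (hh.smooth _ _ _ hX hY))).add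
    (hh.smooth _ _ _ (hX.bracket hY) hZ)).sub
    (hh.smooth _ _ _ (hY.bracket hZ) hX)).add
    (hh.smooth _ _ _ (hZ.bracket hX) hY))

theorem exists_eq_of_nondegenerate {B : E →L[ℝ] E →L[ℝ] ℝ} (hB : ∀ u, (∀ v, B u v = 0) → u = 0)
    (φ : E →L[ℝ] ℝ) : ∃ u, B u = φ := by
  have hinj : Function.Injective (B : E →ₗ[ℝ] E →L[ℝ] ℝ) := by
    rw [injective_iff_map_eq_zero]
    intro u hu
    refine hB u fun v => ?_
    have : B u = 0 := hu
    simp [this]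
  have hfin : Module.finrank ℝ E = Module.finrank ℝ (E →L[ℝ] ℝ) := by
    rw [← (LinearMap.toContinuousLinearMap (𝕜 := ℝ) (E := E) (F' := ℝ)).finrank_eq]
    exact Subspace.dual_finrank_eq.symm
  exact (LinearMap.injective_iff_surjective_of_finrank_eq_finrank hfin).1 hinj φ

namespace IsPseudoMetric

/-- The choice in `leviCivita` is legitimate: the Koszul expression is tensorial in `Z`, so it is a
linear functional on the tangent space, which nondegeneracy represents by a vector. -/
theorem leviCivita_apply (hh : IsPseudoMetric h) (hX : DiffAt X p) (hY : DiffAt Y p) (hZ : DiffAt Z p) :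
    h p (leviCivita h X Y p) (Z p) = koszul h X Y Z p := by
  have hT := hh.tensorialAt_koszul hX hY
  have hex : ∃ v : TangentSpace 𝓘(ℝ, E) p, ∀ Z : VField E M, DiffAt Z p →
      h p v (Z p) = koszul h X Y Z p := by
    obtain ⟨v, hv⟩ := exists_eq_of_nondegenerate (E := E) (B := h p) (hh.nondegenerate p)
      (TensorialAt.mkHom _ p hT)
    exact ⟨v, fun Z hZ => (congrArg (fun l : E →L[ℝ] ℝ => l (Z p)) hv).trans
      (TensorialAt.mkHom_apply hT hZ)⟩
  exact Classical.epsilon_spec hex Z hZ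

theorem leviCivita_apply_extend (hh : IsPseudoMetric h) (hX : DiffAt X p) (hY : DiffAt Y p)
    (w : TangentSpace 𝓘(ℝ, E) p) :
    h p (leviCivita h X Y p) w = koszul h X Y (FiberBundle.extend E w) p := by
  have := hh.leviCivita_apply hX hY (smoothAt_extend w).diff
  rwa [extend_self] at this

theorem leviCivita_eq (hh : IsPseudoMetric h) {v : TangentSpace 𝓘(ℝ, E) p} (hX : DiffAt X p) (hY : DiffAt Y p)
    (hv : ∀ Z, SmoothAt Z p → h p v (Z p) = koszul h X Y Z p) : leviCivita h X Y p = v := by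
  refine hh.eq_of_apply_eq fun w => ?_
  rw [hh.leviCivita_apply_extend hX hY, ← hv _ (smoothAt_extend w), extend_self]

theorem torsion_free (hh : IsPseudoMetric h) (hX : DiffAt X p) (hY : DiffAt Y p) :
    leviCivita h X Y p - leviCivita h Y X p = bracket X Y p := by
  refine hh.eq_of_apply_eq fun w => ?_
  rw [map_sub, sub_apply, hh.leviCivita_apply_extend hX hY,
    hh.leviCivita_apply_extend hY hX, hh.koszul_sub_koszul_swap, extend_self]

theorem dirDeriv_metric (hh : IsPseudoMetric h) (hX : DiffAt X p) (hY : DiffAt Y p) (hZ : DiffAt Z p) :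
    dirDeriv X (fun q => h q (Y q) (Z q)) p
      = h p (leviCivita h X Y p) (Z p) + h p (Y p) (leviCivita h X Z p) := by
  rw [hh.symm p (Y p), hh.leviCivita_apply hX hY hZ, hh.leviCivita_apply hX hZ hY,
    hh.koszul_add_koszul]

/-- The first argument is tensorial, so its value at `p` suffices; the second is differentiated, so
its germ is required. -/
theorem leviCivita_congr (hh : IsPseudoMetric h) (hXX' : X p = X' p) (hX : DiffAt X p)
    (hX' : DiffAt X' p) (hYY' : Y =ᶠ[𝓝 p] Y') (hY : DiffAt Y p) :
    leviCivita h X Y p = leviCivita h X' Y' p := by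
  have hY' : DiffAt Y' p := hY.congr hYY'.symm
  refine hh.leviCivita_eq hX hY fun Z hZ => ?_
  rw [hh.leviCivita_apply hX' hY' hZ.diff,
    koszul_congr (Filter.EventuallyEq.refl _ X) hYY',
    (hh.tensorialAt_koszul_left hY' hZ.diff).pointwise hX hX' hXX']

theorem leviCivita_smul_left (hh : IsPseudoMetric h) (hf : DiffFnAt (E := E) f p)
    (hX : DiffAt X p) (hY : DiffAt Y p) :
    leviCivita h (f • X) Y p = f p • leviCivita h X Y p := by
  refine hh.leviCivita_eq (hX.smul hf) hY fun Z hZ => ?_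
  rw [hh.koszul_smul_left hX hY hf hZ.diff, ← hh.leviCivita_apply hX hY hZ.diff]
  simp

theorem leviCivita_add_left (hh : IsPseudoMetric h) (hX : DiffAt X p) (hX' : DiffAt X' p)
    (hY : DiffAt Y p) :
    leviCivita h (X + X') Y p = leviCivita h X Y p + leviCivita h X' Y p := by
  refine hh.leviCivita_eq (hX.add hX') hY fun Z hZ => ?_
  rw [hh.koszul_add_left hX hX' hY hZ.diff, ← hh.leviCivita_apply hX hY hZ.diff,
    ← hh.leviCivita_apply hX' hY hZ.diff]
  simp

theorem leviCivita_smul_right (hh : IsPseudoMetric h) (hf : DiffFnAt (E := E) f p)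
    (hX : DiffAt X p) (hY : DiffAt Y p) :
    leviCivita h X (f • Y) p = f p • leviCivita h X Y p + dirDeriv X f p • Y p := by
  refine hh.leviCivita_eq hX (hY.smul hf) fun Z hZ => ?_
  rw [hh.koszul_smul_middle hX hY hf hZ.diff, ← hh.leviCivita_apply hX hY hZ.diff]
  simp

theorem leviCivita_add_right (hh : IsPseudoMetric h) (hX : DiffAt X p) (hY : DiffAt Y p)
    (hY' : DiffAt Y' p) :
    leviCivita h X (Y + Y') p = leviCivita h X Y p + leviCivita h X Y' p := by
  refine hh.leviCivita_eq hX (hY.add hY') fun Z hZ => ?_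
  rw [hh.koszul_add_middle hX hY hY' hZ.diff, ← hh.leviCivita_apply hX hY hZ.diff,
    ← hh.leviCivita_apply hX hY' hZ.diff]
  simp

/-- A vector field whose metric products with all smooth fields are smooth is smooth. -/
theorem smoothAt_of_apply (hh : IsPseudoMetric h) {V : VField E M}
    (hV : ∀ Z, SmoothAt Z p → SmoothFnAt (E := E) (fun q => h q (V q) (Z q)) p) :
    SmoothAt V p := by
  let e := localFrame (E := E) p
  -- Cramer's rule: the products of `V` with the frame are its coefficients times the Gram matrix
  -- `G`, so the coefficients are smooth once `det G` is nonzero at `p`.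
  let G : M → Matrix (Fin e.rank) (Fin e.rank) ℝ :=
    fun q => Matrix.of fun a b => h q (e.field a q) (e.field b q)
  let w : M → Fin e.rank → ℝ := fun q b => h q (V q) (e.field b q)
  have hG : ∀ a b, SmoothFnAt (E := E) (fun q => G q a b) p := fun a b =>
    hh.smooth p _ _ (e.smooth_field a) (e.smooth_field b)
  have hw : ∀ b, SmoothFnAt (E := E) (fun q => w q b) p := fun b => hV _ (e.smooth_field b)
  have hdet : ∀ A : M → Matrix (Fin e.rank) (Fin e.rank) ℝ,
      (∀ a b, SmoothFnAt (E := E) (fun q => A q a b) p) →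
      SmoothFnAt (E := E) (fun q => (A q).det) p := by
    intro A hA
    simp only [Matrix.det_apply']
    exact contMDiffAt_finsetSum fun σ _ => contMDiffAt_const.mul
      (contMDiffAt_finsetProd fun a _ => hA _ _)
  have hadj : ∀ a b, SmoothFnAt (E := E) (fun q => (G q).adjugate a b) p := by
    intro a b
    simp only [Matrix.adjugate_apply]
    refine hdet _ fun c d => ?_
    by_cases hc : c = b
    · subst hc
      simpa using contMDiffAt_const
    · simpa [Matrix.updateRow_ne hc] using hG c d
  have hne : (G p).det ≠ 0 := by
    intro h0
    obtain ⟨v, hv0, hv⟩ := Matrix.exists_vecMul_eq_zero_iff.2 h0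
    -- A kernel vector of the Gram matrix would give a combination of the frame orthogonal to every
    -- vector.
    have hz : ∑ a, v a • e.field a p = 0 := by
      refine hh.nondegenerate p _ fun u => ?_
      rw [e.expand.self_of_nhds u]
      simp only [map_sum, map_smul]
      refine Finset.sum_eq_zero fun b _ => ?_
      have := congrFun hv b
      simp only [Matrix.vecMul, dotProduct, G, Matrix.of_apply, Pi.zero_apply] at this
      simp [sum_apply, this]
    refine hv0 (funext fun a => ?_)
    have := congrArg (e.coeff a p) hz
    simpa [e.coeff_field] using this
  have hdetG := hdet G hG
  have hne' : ∀ᶠ q in 𝓝 p, (G q).det ≠ 0 :=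
    ContinuousAt.eventually_ne (ContMDiffAt.continuousAt hdetG) hne
  have hcoef : ∀ a, SmoothFnAt (E := E)
      (fun q => (∑ b, w q b * (G q).adjugate b a) / (G q).det) p := fun a =>
    (contMDiffAt_finsetSum fun b _ => (hw b).mul (hadj b a)).div₀ hdetG hne
  refine SmoothAt.congr (SmoothAt.sum (s := Finset.univ) fun a _ =>
    SmoothAt.smul (hcoef a) (e.smooth_field a)) ?_
  filter_upwards [e.expand, hne'] with q hq hd
  conv_lhs => rw [hq (V q)]
  refine Finset.sum_congr rfl fun a _ => ?_
  simp only [Pi.smul_apply']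
  congr 1
  rw [eq_div_iff hd]
  have hwG : w q = Matrix.vecMul (fun a => e.coeff a q (V q)) (G q) := by
    funext b
    simp only [w, Matrix.vecMul, dotProduct, G, Matrix.of_apply]
    conv_lhs => rw [hq (V q)]
    simp [sum_apply]
  have : Matrix.vecMul (w q) (G q).adjugate = (G q).det • (fun a => e.coeff a q (V q)) := by
    rw [hwG, Matrix.vecMul_vecMul, Matrix.mul_adjugate, Matrix.vecMul_smul, Matrix.vecMul_one]
  have := congrFun this a
  simp only [Matrix.vecMul, dotProduct, Pi.smul_apply, smul_eq_mul] at this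
  rw [this, mul_comm]

theorem smoothAt_leviCivita (hh : IsPseudoMetric h) (hX : SmoothAt X p) (hY : SmoothAt Y p) :
    SmoothAt (leviCivita h X Y) p := by
  refine hh.smoothAt_of_apply fun Z hZ => (hh.smooth_koszul hX hY hZ).congr_of_eventuallyEq ?_
  filter_upwards [hX.eventually_diff, hY.eventually_diff, hZ.eventually_diff] with q h1 h2 h3
    using hh.leviCivita_apply h1 h2 h3

end IsPseudoMetric

end Forms

/-! ### Tensoriality of the curvature. -/

section Curvature

attribute [local instance] isManifold_one isManifold_two isManifold_minSmoothness_two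
  isManifold_minSmoothness_three isManifold_top_add_one

variable {E : Type*} [NormedAddCommGroup E] [NormedSpace ℝ E] [FiniteDimensional ℝ E]
  {M : Type*} [TopologicalSpace M] [ChartedSpace E M] [IsManifold 𝓘(ℝ, E) ∞ M]
  {h : BilinField E M} {X X' Y Y' Z Z' : VField E M} {f : M → ℝ} {p : M}

namespace IsPseudoMetric

theorem curvature_swap (hh : IsPseudoMetric h) (hX : SmoothAt X p) (hY : SmoothAt Y p)
    (hZ : SmoothAt Z p) :
    curvature (leviCivita h) X Y Z p = -curvature (leviCivita h) Y X Z p := by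
  have hc : DiffFnAt (E := E) (fun _ : M => (-1 : ℝ)) p := mdifferentiableAt_const
  have hb := (hY.bracket hX).diff
  have h1 : leviCivita h (bracket X Y) Z p = -leviCivita h (bracket Y X) Z p := by
    rw [hh.leviCivita_congr (X' := (fun _ : M => (-1 : ℝ)) • bracket Y X)
      (by simp [bracket_swap X Y]) (hX.bracket hY).diff (hb.smul hc)
      (Filter.EventuallyEq.refl _ Z) hZ.diff, hh.leviCivita_smul_left hc hb hZ.diff, neg_one_smul]
  simp only [curvature, h1]
  abel

theorem curvature_add_left (hh : IsPseudoMetric h) (hX : SmoothAt X p) (hX' : SmoothAt X' p)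
    (hY : SmoothAt Y p) (hZ : SmoothAt Z p) :
    curvature (leviCivita h) (X + X') Y Z p
      = curvature (leviCivita h) X Y Z p + curvature (leviCivita h) X' Y Z p := by
  have e : Z =ᶠ[𝓝 p] Z := Filter.EventuallyEq.refl _ _
  have h1 : leviCivita h (X + X') Z =ᶠ[𝓝 p] leviCivita h X Z + leviCivita h X' Z := by
    filter_upwards [hX.eventually_diff, hX'.eventually_diff, hZ.eventually_diff] with q h1 h2 h3
      using hh.leviCivita_add_left h1 h2 h3
  have hXZ := hh.smoothAt_leviCivita hX hZ
  have hX'Z := hh.smoothAt_leviCivita hX' hZ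
  have hb := (hX.bracket hY).diff
  have hb' := (hX'.bracket hY).diff
  simp only [curvature]
  rw [hh.leviCivita_add_left hX.diff hX'.diff (hh.smoothAt_leviCivita hY hZ).diff,
    hh.leviCivita_congr rfl hY.diff hY.diff h1 (hh.smoothAt_leviCivita (hX.add hX') hZ).diff,
    hh.leviCivita_add_right hY.diff hXZ.diff hX'Z.diff,
    hh.leviCivita_congr (X' := bracket X Y + bracket X' Y) (bracket_add_left hX.diff hX'.diff)
      ((hX.add hX').bracket hY).diff (hb.add hb') e hZ.diff,
    hh.leviCivita_add_left hb hb' hZ.diff]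
  abel

theorem curvature_smul_left (hh : IsPseudoMetric h) (hf : SmoothFnAt (E := E) f p)
    (hX : SmoothAt X p) (hY : SmoothAt Y p) (hZ : SmoothAt Z p) :
    curvature (leviCivita h) (f • X) Y Z p = f p • curvature (leviCivita h) X Y Z p := by
  have e : Z =ᶠ[𝓝 p] Z := Filter.EventuallyEq.refl _ _
  have h1 : leviCivita h (f • X) Z =ᶠ[𝓝 p] f • leviCivita h X Z := by
    filter_upwards [hX.eventually_diff, hf.eventually_diff, hZ.eventually_diff] with q h1 h2 h3
      using hh.leviCivita_smul_left h2 h1 h3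
  have hXZ := hh.smoothAt_leviCivita hX hZ
  have hb := (hX.bracket hY).diff
  have hd : DiffFnAt (E := E) (fun q => -dirDeriv Y f q) p := (hf.dirDeriv hY).diff.neg
  have hbr : bracket (f • X) Y p = ((fun q => -dirDeriv Y f q) • X + f • bracket X Y) p :=
    bracket_smul_left hf.diff hX.diff
  simp only [curvature]
  rw [hh.leviCivita_smul_left hf.diff hX.diff (hh.smoothAt_leviCivita hY hZ).diff,
    hh.leviCivita_congr rfl hY.diff hY.diff h1 (hh.smoothAt_leviCivita (hX.smul hf) hZ).diff,
    hh.leviCivita_smul_right hf.diff hY.diff hXZ.diff,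
    hh.leviCivita_congr hbr ((hX.smul hf).bracket hY).diff
      ((hX.diff.smul hd).add (hb.smul hf.diff)) e hZ.diff,
    hh.leviCivita_add_left (hX.diff.smul hd) (hb.smul hf.diff) hZ.diff,
    hh.leviCivita_smul_left hf.diff hb hZ.diff, hh.leviCivita_smul_left hd hX.diff hZ.diff]
  module

theorem curvature_add_right (hh : IsPseudoMetric h) (hX : SmoothAt X p) (hY : SmoothAt Y p)
    (hZ : SmoothAt Z p) (hZ' : SmoothAt Z' p) :
    curvature (leviCivita h) X Y (Z + Z') p
      = curvature (leviCivita h) X Y Z p + curvature (leviCivita h) X Y Z' p := by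
  have key : ∀ {U V : VField E M}, SmoothAt U p → SmoothAt V p →
      leviCivita h V (leviCivita h U (Z + Z')) p
        = leviCivita h V (leviCivita h U Z) p + leviCivita h V (leviCivita h U Z') p := by
    intro U V hU hV
    have h1 : leviCivita h U (Z + Z') =ᶠ[𝓝 p] leviCivita h U Z + leviCivita h U Z' := by
      filter_upwards [hU.eventually_diff, hZ.eventually_diff, hZ'.eventually_diff] with q h1 h2 h3
        using hh.leviCivita_add_right h1 h2 h3
    rw [hh.leviCivita_congr rfl hV.diff hV.diff h1 (hh.smoothAt_leviCivita hU (hZ.add hZ')).diff,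
      hh.leviCivita_add_right hV.diff (hh.smoothAt_leviCivita hU hZ).diff
        (hh.smoothAt_leviCivita hU hZ').diff]
  simp only [curvature]
  rw [key hX hY, key hY hX, hh.leviCivita_add_right (hX.bracket hY).diff hZ.diff hZ'.diff]
  abel

theorem curvature_smul_right (hh : IsPseudoMetric h) (hf : SmoothFnAt (E := E) f p)
    (hX : SmoothAt X p) (hY : SmoothAt Y p) (hZ : SmoothAt Z p) :
    curvature (leviCivita h) X Y (f • Z) p = f p • curvature (leviCivita h) X Y Z p := by
  have key : ∀ {U V : VField E M}, SmoothAt U p → SmoothAt V p →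
      leviCivita h V (leviCivita h U (f • Z)) p
        = f p • leviCivita h V (leviCivita h U Z) p + dirDeriv V f p • leviCivita h U Z p
          + (dirDeriv U f p • leviCivita h V Z p + dirDeriv V (dirDeriv U f) p • Z p) := by
    intro U V hU hV
    have h1 : leviCivita h U (f • Z) =ᶠ[𝓝 p] f • leviCivita h U Z + dirDeriv U f • Z := by
      filter_upwards [hU.eventually_diff, hZ.eventually_diff, hf.eventually_diff] with q h1 h2 h3
        using hh.leviCivita_smul_right h3 h1 h2
    have hUZ := (hh.smoothAt_leviCivita hU hZ).diff
    have hUf := (hf.dirDeriv hU).diff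
    rw [hh.leviCivita_congr rfl hV.diff hV.diff h1 (hh.smoothAt_leviCivita hU (hZ.smul hf)).diff,
      hh.leviCivita_add_right hV.diff (hUZ.smul hf.diff) (hZ.diff.smul hUf),
      hh.leviCivita_smul_right hf.diff hV.diff hUZ, hh.leviCivita_smul_right hUf hV.diff hZ.diff]
  simp only [curvature]
  rw [key hX hY, key hY hX, hh.leviCivita_smul_right hf.diff (hX.bracket hY).diff hZ.diff,
    dirDeriv_bracket (ContMDiffAt.of_le hX (natCast_le_infty 2))
      (ContMDiffAt.of_le hY (natCast_le_infty 2)) (ContMDiffAt.of_le hf (natCast_le_infty 2))]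
  module

theorem curvature_congr (hh : IsPseudoMetric h) (hX : SmoothAt X p) (hX' : SmoothAt X' p)
    (hY : SmoothAt Y p) (hY' : SmoothAt Y' p) (hZ : SmoothAt Z p) (hZ' : SmoothAt Z' p)
    (hXX' : X p = X' p) (hYY' : Y p = Y' p) (hZZ' : Z p = Z' p) :
    curvature (leviCivita h) X Y Z p = curvature (leviCivita h) X' Y' Z' p := by
  have h1 : ∀ {U V V' W : VField E M}, SmoothAt U p → SmoothAt W p → SmoothAt V p →
      SmoothAt V' p → V p = V' p →
      curvature (leviCivita h) V U W p = curvature (leviCivita h) V' U W p :=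
    fun hU hW hV hV' hVV' => eq_of_smooth_tensorial
      (Φ := fun V => (curvature (leviCivita h) V _ _ p : TangentSpace 𝓘(ℝ, E) p))
      (fun _ _ h1 h2 => hh.curvature_add_left h1 h2 hU hW)
      (fun _ _ h1 h2 => hh.curvature_smul_left h1 h2 hU hW) hV hV' hVV'
  -- The second slot is reduced to the first by antisymmetry.
  rw [h1 hY hZ hX hX' hXX', hh.curvature_swap hX' hY hZ, h1 hX' hZ hY hY' hYY',
    ← hh.curvature_swap hX' hY' hZ]
  exact eq_of_smooth_tensorial
    (Φ := fun V => (curvature (leviCivita h) X' Y' V p : TangentSpace 𝓘(ℝ, E) p))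
    (fun _ _ h1 h2 => hh.curvature_add_right hX' hY' h1 h2)
    (fun _ _ h1 h2 => hh.curvature_smul_right h1 hX' hY' h2) hZ hZ' hZZ'

/-- The curvature `h(R(X, Y) Y, X)` in terms of first-order data. -/
theorem apply_curvature (hh : IsPseudoMetric h) (hX : SmoothAt X p) (hY : SmoothAt Y p) :
    h p (curvature (leviCivita h) X Y Y p) (X p)
      = dirDeriv X (koszul h Y Y X) p - h p (leviCivita h Y Y p) (leviCivita h X X p)
        - (dirDeriv Y (koszul h X Y X) p - h p (leviCivita h X Y p) (leviCivita h Y X p))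
        - koszul h (bracket X Y) Y X p := by
  -- Differentiating `h(∇_U Y, X)`, which is a Koszul function near `p`, replaces the second
  -- covariant derivative by the derivative of a function and a product of first derivatives.
  have key : ∀ {U V : VField E M}, SmoothAt U p → SmoothAt V p →
      h p (leviCivita h V (leviCivita h U Y) p) (X p) = dirDeriv V (koszul h U Y X) p
        - h p (leviCivita h U Y p) (leviCivita h V X p) := by
    intro U V hU hV
    have h1 := hh.dirDeriv_metric hV.diff (hh.smoothAt_leviCivita hU hY).diff hX.diff
    rw [dirDeriv_congr (f' := koszul h U Y X)] at h1
    · rw [h1]; ring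
    · filter_upwards [hU.eventually_diff, hY.eventually_diff, hX.eventually_diff] with q h1 h2 h3
        using hh.leviCivita_apply h1 h2 h3
  simp only [curvature, map_sub, sub_apply]
  rw [key hY hX, key hX hY, hh.leviCivita_apply (hX.bracket hY).diff hY.diff hX.diff]

end IsPseudoMetric

end Curvature

/-! ### Transverse curvature of a Riemannian flow. -/

section Flow

attribute [local instance] isManifold_one isManifold_two isManifold_minSmoothness_two
  isManifold_minSmoothness_three isManifold_top_add_one

variable {E : Type*} [NormedAddCommGroup E] [NormedSpace ℝ E]
  {M : Type*} [TopologicalSpace M] [ChartedSpace E M]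
  {h : BilinField E M} {ξ X Y Z W : VField E M} {p : M}

theorem vertical_apply (hξ : h p (ξ p) (ξ p) = 1) (W : VField E M) :
    vertical h ξ W p = h p (W p) (ξ p) • ξ p := by
  simp [vertical, hξ]

theorem horizontal_of_apply_eq_zero (hW : h p (W p) (ξ p) = 0) : horizontal h ξ W p = W p := by
  simp [horizontal, vertical, hW]

theorem horizontal_of_eq_zero (hW : W p = 0) : horizontal h ξ W p = 0 := by
  simp [horizontal, vertical, hW]

theorem apply_horizontal (hξ : h p (ξ p) (Z p) = 0) (W : VField E M) :
    h p (horizontal h ξ W p) (Z p) = h p (W p) (Z p) := by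
  simp [horizontal, vertical, hξ]

variable [IsManifold 𝓘(ℝ, E) ∞ M]

namespace IsRiemannianFlow

theorem isPseudoMetric (hF : IsRiemannianFlow h ξ) : IsPseudoMetric h where
  symm := hF.symm
  smooth := hF.smooth_metric
  nondegenerate p u hu := by
    by_contra h0
    exact (hF.pos p u h0).ne' (hu u)

theorem smooth_vertical (hF : IsRiemannianFlow h ξ) (hW : SmoothAt W p) :
    SmoothAt (vertical h ξ W) p := by
  have h1 : SmoothFnAt (E := E) (fun q => h q (W q) (ξ q) / h q (ξ q) (ξ q)) p :=
    (hF.smooth_metric p _ _ hW (hF.smooth_field p)).div₀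
      (hF.smooth_metric p _ _ (hF.smooth_field p) (hF.smooth_field p))
      (hF.pos p _ (hF.ne_zero p)).ne'
  exact SmoothAt.smul h1 (hF.smooth_field p)

theorem smooth_horizontal (hF : IsRiemannianFlow h ξ) (hW : SmoothAt W p) :
    SmoothAt (horizontal h ξ W) p :=
  hW.sub (hF.smooth_vertical hW)

variable [FiniteDimensional ℝ E]

/-- The vertical part of `X` vanishes as a germ, which kills the bracket term. An equality of germs
is needed because the result is differentiated again. -/
theorem transverseConnection_eventuallyEq (hF : IsRiemannianFlow h ξ) (hX : SmoothAt X p)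
    (hXξ : ∀ᶠ q in 𝓝 p, h q (X q) (ξ q) = 0) (hW : SmoothAt W p) :
    transverseConnection h ξ X W =ᶠ[𝓝 p] horizontal h ξ (leviCivita h X W) := by
  have hv : vertical h ξ X =ᶠ[𝓝 p] (0 : VField E M) := hXξ.mono fun q hq => by
    simp only [vertical, hq, zero_div, zero_smul]
    rfl
  filter_upwards [hv.eventuallyEq_nhds, hXξ, hX.eventually_diff, hW.eventually_diff,
    (hF.smooth_horizontal hX).eventually_diff] with q h1 h2 h3 h4 h5
  have e1 : bracket (vertical h ξ X) W q = 0 := by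
    rw [bracket_congr h1 (Filter.EventuallyEq.refl _ W), bracket_zero_left]
  have e2 : leviCivita h (horizontal h ξ X) W q = leviCivita h X W q :=
    hF.isPseudoMetric.leviCivita_congr (horizontal_of_apply_eq_zero h2) h5 h3
      (Filter.EventuallyEq.refl _ W) h4
  rw [transverseConnection, horizontal_of_eq_zero e1, zero_add]
  simp only [horizontal, vertical, e2]
  rfl

/-- The second fundamental form of the orthogonal distribution of a Riemannian flow is
antisymmetric. -/
theorem apply_leviCivita_field (hF : IsRiemannianFlow h ξ) (hX : SmoothAt X p)
    (hY : SmoothAt Y p) (hXξ : ∀ᶠ q in 𝓝 p, h q (X q) (ξ q) = 0)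
    (hYξ : ∀ᶠ q in 𝓝 p, h q (Y q) (ξ q) = 0) :
    h p (leviCivita h X Y p) (ξ p) = (1 / 2) * h p (bracket X Y p) (ξ p) := by
  have hh := hF.isPseudoMetric
  have hξ := hF.smooth_field p
  have h1 : h p (leviCivita h X Y p) (ξ p) + h p (Y p) (leviCivita h X ξ p) = 0 := by
    rw [← hh.dirDeriv_metric hX.diff hY.diff hξ.diff]
    exact dirDeriv_eq_zero hYξ
  have h2 : h p (leviCivita h Y X p) (ξ p) + h p (X p) (leviCivita h Y ξ p) = 0 := by
    rw [← hh.dirDeriv_metric hY.diff hX.diff hξ.diff]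
    exact dirDeriv_eq_zero hXξ
  have hv : ∀ᶠ q in 𝓝 p, horizontal h ξ ξ q = 0 := Filter.Eventually.of_forall fun q => by
    simp [horizontal, vertical, div_self (hF.pos q _ (hF.ne_zero q)).ne']
  have h3 := hF.holonomy_invariant p ξ X Y hξ hX hY hv hXξ hYξ
  have hξX : h p (ξ p) (X p) = 0 := by rw [hh.symm]; exact hXξ.self_of_nhds
  have hξY : h p (ξ p) (Y p) = 0 := by rw [hh.symm]; exact hYξ.self_of_nhds
  -- Holonomy invariance along `ξ` becomes the Killing-type equation `h(∇_X ξ, Y) + h(∇_Y ξ, X) =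
  -- 0`.
  rw [apply_horizontal hξY, hh.symm p (X p), apply_horizontal hξX,
    hh.dirDeriv_metric hξ.diff hX.diff hY.diff, ← hh.torsion_free hξ.diff hX.diff,
    ← hh.torsion_free hξ.diff hY.diff] at h3
  rw [← hh.torsion_free hX.diff hY.diff]
  simp only [map_sub, sub_apply] at h3 ⊢
  rw [hh.symm p (leviCivita h ξ Y p), hh.symm p (leviCivita h Y ξ p)] at h3
  rw [hh.symm p (Y p)] at h1
  linear_combination (1 / 2) * h1 + (1 / 2) * h2 - (1 / 2) * h3

/-- O'Neill's formula for a Riemannian flow spanned by a unit field. -/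
theorem transverseSectionalCurvature_eq (hF : IsRiemannianFlow h ξ)
    (hunit : ∀ q, h q (ξ q) (ξ q) = 1) (hX : SmoothAt X p)
    (hY : SmoothAt Y p) (hXξ : ∀ᶠ q in 𝓝 p, h q (X q) (ξ q) = 0)
    (hYξ : ∀ᶠ q in 𝓝 p, h q (Y q) (ξ q) = 0) :
    transverseSectionalCurvature h ξ X Y p
      = h p (curvature (leviCivita h) X Y Y p) (X p)
        + (3 / 4) * h p (bracket X Y p) (ξ p) ^ 2 := by
  have hh := hF.isPseudoMetric
  have hξ := hF.smooth_field p
  have hξX' : ∀ᶠ q in 𝓝 p, h q (ξ q) (X q) = 0 := hXξ.mono fun q hq => by rw [hh.symm, hq]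
  have hξX := hξX'.self_of_nhds
  -- As in `apply_curvature`, but projecting `∇_U Y` removes the product of the `ξ`-components.
  have key : ∀ {U V : VField E M}, SmoothAt U p → SmoothAt V p →
      (∀ᶠ q in 𝓝 p, h q (U q) (ξ q) = 0) → (∀ᶠ q in 𝓝 p, h q (V q) (ξ q) = 0) →
      h p (transverseConnection h ξ V (transverseConnection h ξ U Y) p) (X p)
        = dirDeriv V (koszul h U Y X) p - (h p (leviCivita h U Y p) (leviCivita h V X p)
          - h p (leviCivita h U Y p) (ξ p) * h p (leviCivita h V X p) (ξ p)) := by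
    intro U V hU hV hUξ hVξ
    have hT := hF.transverseConnection_eventuallyEq hU hUξ hY
    have hTs := (hF.smooth_horizontal (hh.smoothAt_leviCivita hU hY)).congr hT
    rw [(hF.transverseConnection_eventuallyEq hV hVξ hTs).eq_of_nhds, apply_horizontal hξX]
    have h1 := hh.dirDeriv_metric hV.diff hTs.diff hX.diff
    rw [dirDeriv_congr (f' := koszul h U Y X)] at h1
    · rw [h1, hT.eq_of_nhds, horizontal, vertical_apply (hunit p)]
      simp only [map_sub, sub_apply, map_smul, smul_apply, smul_eq_mul]
      rw [hh.symm p (ξ p)]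
      ring
    · filter_upwards [hU.eventually_diff, hY.eventually_diff, hX.eventually_diff, hT, hξX']
        with q h1 h2 h3 h4 h5
      rw [h4, apply_horizontal h5, hh.leviCivita_apply h1 h2 h3]
  have hB := hX.bracket hY
  have hvert := hF.smooth_vertical hB
  have hhor := hF.smooth_horizontal hB
  have hφ : SmoothFnAt (E := E) (fun q => h q (bracket X Y q) (ξ q)) p :=
    hh.smooth p _ _ hB hξ
  have hvφ : vertical h ξ (bracket X Y) =ᶠ[𝓝 p] (fun q => h q (bracket X Y q) (ξ q)) • ξ :=
    Filter.Eventually.of_forall fun q => vertical_apply (hunit q) _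
  -- With `φ = h([X, Y], ξ)`, the vertical part of `[X, Y]` is `φ ξ`, and `[φ ξ, Y] = ∇_{φ ξ} Y -
  -- ∇_Y (φ ξ)`. The derivative of `φ` multiplies `ξ`, which is orthogonal to `X`; only `-φ h(∇_Y ξ,
  -- X)` is new.
  have hlast : h p (transverseConnection h ξ (bracket X Y) Y p) (X p)
      = koszul h (bracket X Y) Y X p
        - h p (bracket X Y p) (ξ p) * h p (leviCivita h Y ξ p) (X p) := by
    have hsum : leviCivita h (bracket X Y) Y p = leviCivita h (vertical h ξ (bracket X Y)) Y p
        + leviCivita h (horizontal h ξ (bracket X Y)) Y p := by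
      rw [← hh.leviCivita_add_left hvert.diff hhor.diff hY.diff]
      refine hh.leviCivita_congr ?_ hB.diff (hvert.diff.add hhor.diff)
        (Filter.EventuallyEq.refl _ Y) hY.diff
      simp [horizontal]
    have hYv : leviCivita h Y (vertical h ξ (bracket X Y)) p
        = h p (bracket X Y p) (ξ p) • leviCivita h Y ξ p
          + dirDeriv Y (fun q => h q (bracket X Y q) (ξ q)) p • ξ p := by
      rw [hh.leviCivita_congr rfl hY.diff hY.diff hvφ hvert.diff,
        hh.leviCivita_smul_right hφ.diff hY.diff hξ.diff]
    rw [transverseConnection, map_add, add_apply, apply_horizontal hξX, apply_horizontal hξX,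
      ← hh.torsion_free hvert.diff hY.diff, ← hh.leviCivita_apply hB.diff hY.diff hX.diff, hsum,
      hYv]
    simp only [map_sub, map_add, map_smul, sub_apply, add_apply, smul_apply, smul_eq_mul, hξX]
    ring
  have hYX : h p (leviCivita h Y ξ p) (X p) = -h p (leviCivita h Y X p) (ξ p) := by
    have := hh.dirDeriv_metric hY.diff hX.diff hξ.diff
    rw [dirDeriv_eq_zero hXξ, hh.symm p (X p)] at this
    linarith
  -- The `3 / 4` is `1 / 4` from the removed vertical product of `∇_X Y` and `∇_Y X`, plus `1 / 2`
  -- from `hlast`.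
  rw [transverseSectionalCurvature, hh.apply_curvature hX hY]
  simp only [curvature, map_sub, sub_apply]
  rw [key hY hX hYξ hXξ, key hX hY hXξ hYξ, hlast, hYX,
    hF.apply_leviCivita_field hX hX hXξ hXξ, hF.apply_leviCivita_field hY hY hYξ hYξ,
    hF.apply_leviCivita_field hX hY hXξ hYξ, hF.apply_leviCivita_field hY hX hYξ hXξ,
    bracket_swap Y X, show bracket X X p = 0 from congrFun VectorField.mlieBracket_self p]
  simp only [map_neg, neg_apply, map_zero, zero_apply]
  ring

end IsRiemannianFlow

end Flow

/-! ### Immersions: local retractions, extension of fields, related brackets. -/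

section Immersion

attribute [local instance] isManifold_one isManifold_two isManifold_minSmoothness_two
  isManifold_minSmoothness_three isManifold_top_add_one

variable {E : Type*} [NormedAddCommGroup E] [NormedSpace ℝ E]
  {M : Type*} [TopologicalSpace M] [ChartedSpace E M]
  {F : Type*} [NormedAddCommGroup F] [NormedSpace ℝ F]
  {L : Type*} [TopologicalSpace L] [ChartedSpace F L]
  {i : L → M} {p : L}

theorem dirDeriv_comp {X : VField F L} {W : VField E M} {f : M → ℝ}
    (hi : MDifferentiableAt 𝓘(ℝ, F) 𝓘(ℝ, E) i p) (hf : DiffFnAt (E := E) f (i p))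
    (hXW : diff E F i p (X p) = W (i p)) :
    dirDeriv X (fun q => f (i q)) p = dirDeriv W f (i p) := by
  have := mvfderiv_comp_apply p hf hi (X p)
  rw [dirDeriv, dirDeriv, ← hXW]
  exact this

/-- An immersion has a local smooth left inverse. -/
theorem exists_retraction (hi : Manifold.IsImmersionAt 𝓘(ℝ, F) 𝓘(ℝ, E) ∞ i p) :
    ∃ r : M → L, ContMDiffAt 𝓘(ℝ, E) 𝓘(ℝ, F) ∞ r (i p) ∧ ∀ᶠ q in 𝓝 p, r (i q) = q := by
  let φ := hi.domChart
  let ψ := hi.codChart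
  have hmem := hi.mem_domChart_source
  have hchart : ∀ q ∈ φ.source, (hi.equiv.symm (ψ (i q))).1 = φ q := by
    intro q hq
    have hx : (φ q : F) ∈ (hi.domChart.extend 𝓘(ℝ, F)).target := by
      simpa using φ.map_source hq
    have := hi.writtenInCharts hx
    simp only [Function.comp_apply, OpenPartialHomeomorph.extend_coe_symm,
      OpenPartialHomeomorph.extend_coe] at this
    have hleft : φ.symm (φ q) = q := φ.left_inv hq
    simp only [modelWithCornersSelf_coe_symm, modelWithCornersSelf_coe, id_eq] at this
    change ψ (i (φ.symm (φ q))) = _ at this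
    rw [hleft] at this
    rw [this]
    simp
  -- In adapted charts `i` is `u ↦ (u, 0)`, and the retraction is the projection to the first
  -- factor.
  refine ⟨fun m => φ.symm (hi.equiv.symm (ψ m)).1, ?_, ?_⟩
  · have h1 : ContMDiffAt 𝓘(ℝ, E) 𝓘(ℝ, E) ∞ ψ (i p) :=
      contMDiffAt_of_mem_maximalAtlas hi.codChart_mem_maximalAtlas hi.mem_codChart_source
    have h2 : ContMDiffAt 𝓘(ℝ, E) 𝓘(ℝ, F) ∞ (fun x : E => (hi.equiv.symm x).1) (ψ (i p)) :=
      (contDiff_fst.comp hi.equiv.symm.contDiff).contDiffAt.contMDiffAt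
    have h3 : ContMDiffAt 𝓘(ℝ, F) 𝓘(ℝ, F) ∞ φ.symm (hi.equiv.symm (ψ (i p))).1 := by
      rw [hchart p hmem]
      exact contMDiffAt_symm_of_mem_maximalAtlas hi.domChart_mem_maximalAtlas
        (φ.map_source hmem)
    exact h3.comp (i p) (h2.comp (i p) h1)
  · filter_upwards [φ.open_source.mem_nhds hmem] with q hq
    rw [hchart q hq, φ.left_inv hq]

/-- Chain rule for `r ∘ i = id` near `p`, with `r` the local retraction. -/
theorem diff_injective (hi : Manifold.IsImmersionAt 𝓘(ℝ, F) 𝓘(ℝ, E) ∞ i p) :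
    Function.Injective (diff E F i p) := by
  obtain ⟨r, hr, hri⟩ := exists_retraction hi
  have h1 : mfderiv 𝓘(ℝ, F) 𝓘(ℝ, F) (r ∘ i) p = ContinuousLinearMap.id ℝ _ := by
    rw [Filter.EventuallyEq.mfderiv_eq (f₁ := r ∘ i) (f := id) hri]
    exact mfderiv_id
  rw [mfderiv_comp p (hr.mdifferentiableAt (by simp)) (hi.contMDiffAt.mdifferentiableAt (by simp))]
    at h1
  intro u v huv
  have hu := congrArg (fun l : F →L[ℝ] F => l u) h1
  have hv := congrArg (fun l : F →L[ℝ] F => l v) h1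
  have huv' : mfderiv 𝓘(ℝ, E) 𝓘(ℝ, F) r (i p) (diff E F i p u)
    = mfderiv 𝓘(ℝ, E) 𝓘(ℝ, F) r (i p) (diff E F i p v) := by rw [huv]
  exact (hu.symm.trans huv').trans hv

variable [IsManifold 𝓘(ℝ, E) ∞ M]

/-- The vector field `V` along `i : L → M` is smooth at `p`. -/
def SmoothAlongAt (F : Type*) [NormedAddCommGroup F] [NormedSpace ℝ F]
    {L : Type*} [TopologicalSpace L] [ChartedSpace F L] (i : L → M)
    (V : (q : L) → TangentSpace 𝓘(ℝ, E) (i q)) (p : L) : Prop :=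
  ContMDiffAt 𝓘(ℝ, F) 𝓘(ℝ, E).tangent ∞ (fun q => (⟨i q, V q⟩ : TangentBundle 𝓘(ℝ, E) M)) p

theorem SmoothAt.comp_smoothAlongAt {ζ : VField E M} (hζ : SmoothAt ζ (i p))
    (hi : ContMDiffAt 𝓘(ℝ, F) 𝓘(ℝ, E) ∞ i p) : SmoothAlongAt F i (fun q => ζ (i q)) p :=
  ContMDiffAt.comp p hζ hi

/-- A smooth vector field along an immersion extends locally to the ambient manifold. -/
theorem exists_extension (hi : Manifold.IsImmersionAt 𝓘(ℝ, F) 𝓘(ℝ, E) ∞ i p)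
    {V : (q : L) → TangentSpace 𝓘(ℝ, E) (i q)} (hV : SmoothAlongAt F i V p) :
    ∃ W : VField E M, SmoothAt W (i p) ∧ ∀ᶠ q in 𝓝 p, W (i q) = V q := by
  obtain ⟨r, hr, hri⟩ := exists_retraction hi
  let t := trivializationAt E (TangentSpace 𝓘(ℝ, E) : M → Type _) (i p)
  have hip : i p ∈ t.baseSet := FiberBundle.mem_baseSet_trivializationAt' (i p)
  have hv := (contMDiffAt_totalSpace.1 hV).2
  have hrp : r (i p) = p := hri.self_of_nhds
  -- The value of `V` at `r m` is read in a trivialization near `i p` and the same coordinates are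
  -- put back over `m`; this makes the extension constant along the fibres of `r` in coordinates.
  refine ⟨fun m => t.symm m (t ⟨i (r m), V (r m)⟩).2, ?_, ?_⟩
  · refine (contMDiffAt_section _).2 ?_
    have h1 : ContMDiffAt 𝓘(ℝ, E) 𝓘(ℝ, E) ∞ (fun m => (t ⟨i (r m), V (r m)⟩).2) (i p) :=
      ContMDiffAt.comp (g := fun q => (t ⟨i q, V q⟩).2) (i p) (by rw [hrp]; exact hv) hr
    refine h1.congr_of_eventuallyEq ?_
    filter_upwards [t.open_baseSet.mem_nhds hip] with m hm
    have := congrArg Prod.snd (t.apply_mk_symm hm (t ⟨i (r m), V (r m)⟩).2)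
    exact this
  · filter_upwards [hri, hi.contMDiffAt.continuousAt.preimage_mem_nhds
      (t.open_baseSet.mem_nhds hip)] with q hq hq'
    rw [hq]
    exact t.symm_apply_apply_mk hq' (V q)

variable [IsManifold 𝓘(ℝ, F) ∞ L]

theorem SmoothAt.diff_smoothAlongAt {X : VField F L} (hX : SmoothAt X p)
    (hi : ContMDiffAt 𝓘(ℝ, F) 𝓘(ℝ, E) ∞ i p) :
    SmoothAlongAt F i (fun q => RiggedNull.diff E F i q (X q)) p :=
  ContMDiffAt.clm_apply_of_inCoordinates (hi.mfderiv_const (by simp)) hX hi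

theorem exists_related (hi : Manifold.IsImmersionAt 𝓘(ℝ, F) 𝓘(ℝ, E) ∞ i p) {X : VField F L}
    (hX : SmoothAt X p) :
    ∃ W : VField E M, SmoothAt W (i p) ∧ ∀ᶠ q in 𝓝 p, diff E F i q (X q) = W (i q) := by
  obtain ⟨W, hW, h⟩ := exists_extension hi (hX.diff_smoothAlongAt hi.contMDiffAt)
  exact ⟨W, hW, h.mono fun q hq => hq.symm⟩

/-- Linear functionals composed with a chart already separate tangent vectors. -/
theorem eq_of_forall_mvfderiv_eq {m : M} {u v : TangentSpace 𝓘(ℝ, E) m}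
    (huv : ∀ f : M → ℝ, SmoothFnAt (E := E) f m →
      mvfderiv 𝓘(ℝ, E) f m u = mvfderiv 𝓘(ℝ, E) f m v) : u = v := by
  have hinv := isInvertible_mfderiv_extChartAt (I := 𝓘(ℝ, E)) (mem_extChartAt_source (I := 𝓘(ℝ, E)) m)
  refine hinv.injective (?_ : (mfderiv 𝓘(ℝ, E) 𝓘(ℝ, E) (extChartAt 𝓘(ℝ, E) m) m u : E)
    = mfderiv 𝓘(ℝ, E) 𝓘(ℝ, E) (extChartAt 𝓘(ℝ, E) m) m v)
  refine (SeparatingDual.eq_iff_forall_dual_eq (R := ℝ) (V := E)).2 fun l => ?_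
  have hchart : ContMDiffAt 𝓘(ℝ, E) 𝓘(ℝ, E) ∞ (extChartAt 𝓘(ℝ, E) m) m := contMDiffAt_extChartAt
  have hl : ContMDiffAt 𝓘(ℝ, E) 𝓘(ℝ, ℝ) ∞ l (extChartAt 𝓘(ℝ, E) m m) :=
    l.contDiff.contDiffAt.contMDiffAt
  have h1 := huv (l ∘ extChartAt 𝓘(ℝ, E) m) (hl.comp m hchart)
  have h2 : ∀ w : TangentSpace 𝓘(ℝ, E) m,
      mvfderiv 𝓘(ℝ, E) (l ∘ extChartAt 𝓘(ℝ, E) m) m w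
        = l (mfderiv 𝓘(ℝ, E) 𝓘(ℝ, E) (extChartAt 𝓘(ℝ, E) m) m w) := by
    intro w
    have := mvfderiv_comp_apply m (hl.mdifferentiableAt (by simp))
      (hchart.mdifferentiableAt (by simp)) w
    rw [this, mvfderiv, mfderiv_eq_fderiv, l.fderiv]
    rfl
  rwa [h2, h2] at h1

variable [FiniteDimensional ℝ E] [FiniteDimensional ℝ F]

/-- Lie brackets of `i`-related vector fields are `i`-related. -/
theorem diff_bracket {X Y : VField F L} {X' Y' : VField E M} 
    (hi : ContMDiff 𝓘(ℝ, F) 𝓘(ℝ, E) ∞ i)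
    (hX : ContMDiffAt 𝓘(ℝ, F) 𝓘(ℝ, F).tangent 2
      (fun q => (⟨q, X q⟩ : TangentBundle 𝓘(ℝ, F) L)) p)
    (hY : ContMDiffAt 𝓘(ℝ, F) 𝓘(ℝ, F).tangent 2
      (fun q => (⟨q, Y q⟩ : TangentBundle 𝓘(ℝ, F) L)) p)
    (hX' : ContMDiffAt 𝓘(ℝ, E) 𝓘(ℝ, E).tangent 2
      (fun q => (⟨q, X' q⟩ : TangentBundle 𝓘(ℝ, E) M)) (i p))
    (hY' : ContMDiffAt 𝓘(ℝ, E) 𝓘(ℝ, E).tangent 2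
      (fun q => (⟨q, Y' q⟩ : TangentBundle 𝓘(ℝ, E) M)) (i p))
    (hXX' : ∀ᶠ q in 𝓝 p, diff E F i q (X q) = X' (i q))
    (hYY' : ∀ᶠ q in 𝓝 p, diff E F i q (Y q) = Y' (i q)) :
    diff E F i p (bracket X Y p) = bracket X' Y' (i p) := by
  have hid : ∀ q, MDifferentiableAt 𝓘(ℝ, F) 𝓘(ℝ, E) i q := fun q =>
    (hi q).mdifferentiableAt (by simp)
  -- Both sides act on functions as commutators, and the chain rule matches these derivations.
  refine eq_of_forall_mvfderiv_eq fun f hf => ?_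
  have hf2 : ContMDiffAt 𝓘(ℝ, E) 𝓘(ℝ, ℝ) 2 f (i p) := hf.of_le (natCast_le_infty 2)
  have hfi : ContMDiffAt 𝓘(ℝ, F) 𝓘(ℝ, ℝ) 2 (fun q => f (i q)) p :=
    (hf.comp p (hi p)).of_le (natCast_le_infty 2)
  have hdiff : ∀ {U : VField E M}, ContMDiffAt 𝓘(ℝ, E) 𝓘(ℝ, E).tangent 2
      (fun q => (⟨q, U q⟩ : TangentBundle 𝓘(ℝ, E) M)) (i p) →
      DiffFnAt (E := E) (dirDeriv U f) (i p) := fun hU =>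
    (contMDiffAt_dirDeriv (m := 1) hf2 (hU.of_le (by norm_num)) (by norm_num)
      (by norm_num)).mdifferentiableAt (by simp)
  have hfn : ∀ᶠ q in 𝓝 p, DiffFnAt (E := E) f (i q) :=
    (hi p).continuousAt.eventually hf.eventually_diff
  have hcomp : ∀ {U : VField F L} {U' : VField E M},
      (∀ᶠ q in 𝓝 p, diff E F i q (U q) = U' (i q)) →
      dirDeriv U (fun q => f (i q)) =ᶠ[𝓝 p] fun q => dirDeriv U' f (i q) := by
    intro U U' hUU'
    filter_upwards [hUU', hfn] with q h1 h2 using dirDeriv_comp (hid q) h2 h1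
  have e1 := dirDeriv_bracket hX hY hfi
  rw [dirDeriv_congr (hcomp hXX'), dirDeriv_congr (hcomp hYY'),
    dirDeriv_comp (hid p) (hdiff hY') hXX'.self_of_nhds,
    dirDeriv_comp (hid p) (hdiff hX') hYY'.self_of_nhds,
    ← dirDeriv_bracket hX' hY' hf2] at e1
  exact (mvfderiv_comp_apply p hf.diff (hid p) (bracket X Y p)).symm.trans e1

end Immersion

/-! ### The induced form and its Koszul expression. -/

section Pullback

attribute [local instance] isManifold_one isManifold_two isManifold_minSmoothness_two
  isManifold_minSmoothness_three isManifold_top_add_one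

variable {E : Type*} [NormedAddCommGroup E] [NormedSpace ℝ E]
  {M : Type*} [TopologicalSpace M] [ChartedSpace E M]
  {F : Type*} [NormedAddCommGroup F] [NormedSpace ℝ F]
  {L : Type*} [TopologicalSpace L] [ChartedSpace F L]
  {g : BilinField E M} {i : L → M} {ζ : VField E M}

/-- The pullback `i^* g`. -/
def pullbackForm (F : Type*) [NormedAddCommGroup F] [NormedSpace ℝ F]
    {L : Type*} [TopologicalSpace L] [ChartedSpace F L]
    (g : BilinField E M) (i : L → M) : BilinField F L := fun p =>
  (ContinuousLinearMap.precomp ℝ (diff E F i p)).comp ((g (i p)).comp (diff E F i p))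

theorem pullbackForm_apply (g : BilinField E M) (i : L → M) (p : L)
    (u v : TangentSpace 𝓘(ℝ, F) p) :
    pullbackForm F g i p u v = g (i p) (diff E F i p u) (diff E F i p v) := rfl

theorem riggedMetric_eq (g : BilinField E M) (i : L → M) (ζ : VField E M) (p : L)
    (u v : TangentSpace 𝓘(ℝ, F) p) :
    riggedMetric F g i ζ p u v = pullbackForm F g i p u v
      + riggedForm F g i ζ p u * riggedForm F g i ζ p v := rfl

variable [IsManifold 𝓘(ℝ, E) ∞ M]

namespace IsLorentzMetric

theorem isPseudoMetric (hg : IsLorentzMetric g) : IsPseudoMetric g where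
  symm := hg.symm
  smooth p X Y hX hY := by
    have h := ContMDiffAt.clm_bundle_apply₂ (F₁ := E) (F₂ := E) (F₃ := ℝ)
      (E₃ := Bundle.Trivial M ℝ) (b := id) (hg.smooth p) hX hY
    exact (contMDiffAt_totalSpace.1 h).2
  nondegenerate p u hu := by
    obtain ⟨t, -, ht⟩ := hg.signature p
    by_contra h0
    exact (ht u (by rw [hg.symm, hu]) h0).ne' (hu u)

theorem smooth_along (hg : IsLorentzMetric g) {V W : (q : L) → TangentSpace 𝓘(ℝ, E) (i q)} {p : L}
    (hi : ContMDiffAt 𝓘(ℝ, F) 𝓘(ℝ, E) ∞ i p)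
    (hV : SmoothAlongAt F i V p) (hW : SmoothAlongAt F i W p) :
    SmoothFnAt (E := F) (fun q => g (i q) (V q) (W q)) p := by
  have h := ContMDiffAt.clm_bundle_apply₂ (F₁ := E) (F₂ := E) (F₃ := ℝ)
    (E₃ := Bundle.Trivial M ℝ) (b := i) (ContMDiffAt.comp p (hg.smooth (i p)) hi) hV hW
  exact (contMDiffAt_totalSpace.1 h).2

/-- The orthogonal complement of a null vector is positive semidefinite, and its radical is
spanned by that vector. -/
theorem nonneg_of_orthogonal_null (hg : IsLorentzMetric g) {m : M} {N V : TangentSpace 𝓘(ℝ, E) m}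
    (hN0 : N ≠ 0) (hN : g m N N = 0) (hNV : g m N V = 0) :
    0 ≤ g m V V ∧ (g m V V = 0 → ∃ c : ℝ, V = c • N) := by
  obtain ⟨t, -, ht⟩ := hg.signature m
  have htN : g m t N ≠ 0 := fun h => (ht N h hN0).ne' hN
  have hVN : g m V N = 0 := by rw [hg.symm, hNV]
  -- Subtracting `c • N` makes `V` orthogonal to the timelike `t` and leaves `g(V, V)` unchanged, as
  -- `N` is null and orthogonal to `V`.
  let c : ℝ := g m t V / g m t N
  have h1 : g m t (V - c • N) = 0 := by
    simp only [map_sub, map_smul, smul_eq_mul, c]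
    field_simp
    ring
  have h2 : g m (V - c • N) (V - c • N) = g m V V := by
    simp [hN, hNV, hVN]
  by_cases h0 : V - c • N = 0
  · have : g m V V = 0 := by rw [← h2, h0]; simp
    exact ⟨this.ge, fun _ => ⟨c, sub_eq_zero.1 h0⟩⟩
  · have := ht _ h1 h0
    rw [h2] at this
    exact ⟨this.le, fun h => absurd h this.ne'⟩

end IsLorentzMetric

variable [IsManifold 𝓘(ℝ, F) ∞ L]

theorem IsLorentzMetric.isSmoothForm_pullbackForm (hg : IsLorentzMetric g)
    (hi : ContMDiff 𝓘(ℝ, F) 𝓘(ℝ, E) ∞ i) : IsSmoothForm (pullbackForm F g i) where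
  symm _ _ _ := hg.symm _ _ _
  smooth p _ _ hX hY :=
    hg.smooth_along (hi p) (hX.diff_smoothAlongAt (hi p)) (hY.diff_smoothAlongAt (hi p))

theorem IsLorentzMetric.smooth_riggedForm (hg : IsLorentzMetric g)
    (hi : ContMDiff 𝓘(ℝ, F) 𝓘(ℝ, E) ∞ i) (hζ : IsRigging F i ζ) {p : L} {X : VField F L}
    (hX : SmoothAt X p) : SmoothFnAt (E := F) (fun q => riggedForm F g i ζ q (X q)) p := by
  obtain ⟨U, -, hiU, hU⟩ := hζ.1
  exact hg.smooth_along (hi p) ((hU (i p) (hiU ⟨p, rfl⟩)).comp_smoothAlongAt (hi p))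
    (hX.diff_smoothAlongAt (hi p))

theorem IsLorentzMetric.isSmoothForm_riggedMetric (hg : IsLorentzMetric g)
    (hi : ContMDiff 𝓘(ℝ, F) 𝓘(ℝ, E) ∞ i) (hζ : IsRigging F i ζ) :
    IsSmoothForm (riggedMetric F g i ζ) where
  symm p u v := by rw [riggedMetric_apply, riggedMetric_apply, hg.symm, mul_comm]
  smooth p X Y hX hY :=
    ((hg.isSmoothForm_pullbackForm hi).smooth p X Y hX hY).add
      ((hg.smooth_riggedForm hi hζ hX).mul (hg.smooth_riggedForm hi hζ hY))

variable [FiniteDimensional ℝ E] [FiniteDimensional ℝ F]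

/-- The Koszul expression is compatible with pullbacks. -/
theorem IsLorentzMetric.koszul_pullbackForm (hg : IsLorentzMetric g)
    (hi : ContMDiff 𝓘(ℝ, F) 𝓘(ℝ, E) ∞ i) {X Y Z : VField F L} {X' Y' Z' : VField E M} {p : L}
    (hX : SmoothAt X p) (hY : SmoothAt Y p) (hZ : SmoothAt Z p)
    (hX' : SmoothAt X' (i p)) (hY' : SmoothAt Y' (i p)) (hZ' : SmoothAt Z' (i p))
    (hXX' : ∀ᶠ q in 𝓝 p, diff E F i q (X q) = X' (i q))
    (hYY' : ∀ᶠ q in 𝓝 p, diff E F i q (Y q) = Y' (i q))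
    (hZZ' : ∀ᶠ q in 𝓝 p, diff E F i q (Z q) = Z' (i q)) :
    koszul (pullbackForm F g i) X Y Z =ᶠ[𝓝 p] fun q => koszul g X' Y' Z' (i q) := by
  have hc := (hi p).continuousAt
  filter_upwards [hX.eventually_contMDiffAt 2, hY.eventually_contMDiffAt 2,
    hZ.eventually_contMDiffAt 2, hc.eventually (hX'.eventually_contMDiffAt 2),
    hc.eventually (hY'.eventually_contMDiffAt 2), hc.eventually (hZ'.eventually_contMDiffAt 2),
    hXX'.eventually_nhds, hYY'.eventually_nhds, hZZ'.eventually_nhds]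
    with q x y z x' y' z' xx yy zz
  have hd : ∀ {U V W : VField F L} {U' V' W' : VField E M},
      (∀ᶠ r in 𝓝 q, diff E F i r (U r) = U' (i r)) →
      (∀ᶠ r in 𝓝 q, diff E F i r (V r) = V' (i r)) →
      (∀ᶠ r in 𝓝 q, diff E F i r (W r) = W' (i r)) →
      DiffAt V' (i q) → DiffAt W' (i q) →
      dirDeriv U (fun r => pullbackForm F g i r (V r) (W r)) q
        = dirDeriv U' (fun r => g r (V' r) (W' r)) (i q) := by
    intro U V W U' V' W' hU hV hW hV' hW'
    rw [← dirDeriv_comp (X := U) ((hi q).mdifferentiableAt (by simp))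
      (hg.isPseudoMetric.diff hV' hW') hU.self_of_nhds]
    refine dirDeriv_congr ?_
    filter_upwards [hV, hW] with r h1 h2
    rw [pullbackForm_apply, h1, h2]
  have hx := x'.mdifferentiableAt (by simp)
  have hy := y'.mdifferentiableAt (by simp)
  have hz := z'.mdifferentiableAt (by simp)
  simp only [koszul]
  rw [hd xx yy zz hy hz, hd yy zz xx hz hx, hd zz xx yy hx hy, pullbackForm_apply,
    pullbackForm_apply, pullbackForm_apply, diff_bracket hi x y x' y' xx yy,
    diff_bracket hi y z y' z' yy zz, diff_bracket hi z x z' x' zz xx, xx.self_of_nhds,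
    yy.self_of_nhds, zz.self_of_nhds]

end Pullback

/-! ### The radical of the induced form and the rigged field. -/

section Radical

theorem eq_zero_of_vanishes_on_range {E : Type*} [NormedAddCommGroup E] [NormedSpace ℝ E]
    [FiniteDimensional ℝ E] {F : Type*} [NormedAddCommGroup F] [NormedSpace ℝ F]
    {l : E →L[ℝ] ℝ} {D : F →L[ℝ] E}
    (hD : Function.Injective D) (hcodim : Module.finrank ℝ E = Module.finrank ℝ F + 1)
    {z : E} (hz : ∀ u, D u ≠ z) (hlD : ∀ u, l (D u) = 0) (hlz : l z = 0) (v : E) : l v = 0 := by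
  have hlt : D.range < l.ker := by
    refine lt_of_le_of_ne ?_ ?_
    · rintro _ ⟨u, rfl⟩
      exact hlD u
    · intro h
      have : z ∈ D.range := by rw [h]; exact hlz
      obtain ⟨u, hu⟩ := this
      exact hz u hu
  have h1 := Submodule.finrank_lt_finrank_of_lt hlt
  have h2 : Module.finrank ℝ D.range = Module.finrank ℝ F := LinearMap.finrank_range_of_inj hD
  have h3 : l.ker = ⊤ :=
    Submodule.eq_top_of_finrank_eq (le_antisymm (Submodule.finrank_le _) (by omega))
  have : v ∈ l.ker := by rw [h3]; trivial
  exact this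

variable {E : Type*} [NormedAddCommGroup E] [NormedSpace ℝ E] [FiniteDimensional ℝ E]
  {M : Type*} [TopologicalSpace M] [ChartedSpace E M] [IsManifold 𝓘(ℝ, E) ∞ M]
  {F : Type*} [NormedAddCommGroup F] [NormedSpace ℝ F]
  {L : Type*} [TopologicalSpace L] [ChartedSpace F L]
  {g : BilinField E M} {i : L → M} {ζ : VField E M}

namespace IsNullHypersurface

/-- If `ω` vanished on a null direction, its image would be orthogonal to the hyperplane `T_pL` and
to the transverse vector `ζ`, hence to everything. So it can be rescaled to `ω = 1`. -/
theorem exists_radical (hi : IsNullHypersurface F g i) (hg : IsLorentzMetric g)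
    (hζ : IsRigging F i ζ) (p : L) : ∃ n : TangentSpace 𝓘(ℝ, F) p,
      riggedForm F g i ζ p n = 1 ∧ ∀ v, pullbackForm F g i p n v = 0 := by
  obtain ⟨n, hn0, hn⟩ := hi.null p
  have hinj := diff_injective (hi.immersion.isImmersionAt p)
  have hω : riggedForm F g i ζ p n ≠ 0 := by
    intro h0
    have h1 : g (i p) (ζ (i p)) (diff E F i p n) = 0 := h0
    rw [hg.symm] at h1
    have h2 : diff E F i p n = 0 := hg.isPseudoMetric.nondegenerate _ _
      (eq_zero_of_vanishes_on_range (E := E) (F := F) (l := g (i p) (diff E F i p n))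
        (D := diff E F i p) hinj hi.codim (z := ζ (i p)) (fun u hu => hζ.2 p ⟨u, hu⟩) hn h1)
    exact hn0 (hinj (h2.trans (map_zero _).symm))
  refine ⟨(riggedForm F g i ζ p n)⁻¹ • n, ?_, fun v => ?_⟩
  · rw [map_smul, smul_eq_mul, inv_mul_cancel₀ hω]
  · rw [map_smul, smul_apply, pullbackForm_apply, hn, smul_zero]

/-- `i^*g` is nonnegative and vanishes only on multiples of `n`, where the square of `ω` takes over.
-/
theorem riggedMetric_pos (hi : IsNullHypersurface F g i) (hg : IsLorentzMetric g)
    (hζ : IsRigging F i ζ) (p : L) (u : TangentSpace 𝓘(ℝ, F) p) (hu : u ≠ 0) :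
    0 < riggedMetric F g i ζ p u u := by
  obtain ⟨n, hn1, hn⟩ := hi.exists_radical hg hζ p
  have hinj := diff_injective (hi.immersion.isImmersionAt p)
  have hN0 : diff E F i p n ≠ 0 := by
    intro h
    have : riggedForm F g i ζ p n = g (i p) (ζ (i p)) (diff E F i p n) := rfl
    rw [hn1, h, map_zero] at this
    exact one_ne_zero this
  obtain ⟨h0, h1⟩ := hg.nonneg_of_orthogonal_null (V := diff E F i p u) hN0 (hn n) (hn u)
  rw [riggedMetric_eq, pullbackForm_apply]
  rcases h0.lt_or_eq with h | h
  · exact add_pos_of_pos_of_nonneg h (mul_self_nonneg _)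
  · obtain ⟨c, hc⟩ := h1 h.symm
    have hun : u = c • n := hinj (by rw [hc, map_smul])
    have hω : riggedForm F g i ζ p u = c := by rw [hun, map_smul, hn1, smul_eq_mul, mul_one]
    have hc0 : c ≠ 0 := fun h => hu (by rw [hun, h, zero_smul])
    rw [← h, hω, zero_add]
    exact mul_self_pos.2 hc0

/-- The normalised radical vector solves the defining equation, which validates the choice in
`riggedField`. -/
theorem riggedMetric_riggedField (hi : IsNullHypersurface F g i) (hg : IsLorentzMetric g)
    (hζ : IsRigging F i ζ) (p : L) (u : TangentSpace 𝓘(ℝ, F) p) :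
    riggedMetric F g i ζ p (riggedField F g i ζ p) u = riggedForm F g i ζ p u := by
  have hex : ∃ v : TangentSpace 𝓘(ℝ, F) p,
      ∀ u, riggedMetric F g i ζ p v u = riggedForm F g i ζ p u := by
    obtain ⟨n, hn1, hn⟩ := hi.exists_radical hg hζ p
    exact ⟨n, fun u => by rw [riggedMetric_eq, hn, hn1, zero_add, one_mul]⟩
  exact Classical.epsilon_spec hex u

variable [IsManifold 𝓘(ℝ, F) ∞ L]

theorem isPseudoMetric_riggedMetric (hi : IsNullHypersurface F g i) (hg : IsLorentzMetric g)
    (hζ : IsRigging F i ζ) : IsPseudoMetric (riggedMetric F g i ζ) where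
  toIsSmoothForm := hg.isSmoothForm_riggedMetric hi.immersion.contMDiff hζ
  nondegenerate p u hu := by
    by_contra h0
    exact (hi.riggedMetric_pos hg hζ p u h0).ne' (hu u)

theorem riggedMetric_riggedField_right (hi : IsNullHypersurface F g i) (hg : IsLorentzMetric g)
    (hζ : IsRigging F i ζ) (p : L) (u : TangentSpace 𝓘(ℝ, F) p) :
    riggedMetric F g i ζ p u (riggedField F g i ζ p) = riggedForm F g i ζ p u := by
  rw [(hi.isPseudoMetric_riggedMetric hg hζ).symm, hi.riggedMetric_riggedField hg hζ]

/-- The rigged field spans the radical of the induced form. -/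
theorem riggedField_spec (hi : IsNullHypersurface F g i) (hg : IsLorentzMetric g)
    (hζ : IsRigging F i ζ) (p : L) :
    riggedForm F g i ζ p (riggedField F g i ζ p) = 1 ∧
      ∀ v, pullbackForm F g i p (riggedField F g i ζ p) v = 0 := by
  obtain ⟨n, hn1, hn⟩ := hi.exists_radical hg hζ p
  have : riggedField F g i ζ p = n := by
    refine (hi.isPseudoMetric_riggedMetric hg hζ).eq_of_apply_eq fun u => ?_
    rw [hi.riggedMetric_riggedField hg hζ, riggedMetric_eq, hn, hn1, zero_add, one_mul]
  rw [this]
  exact ⟨hn1, hn⟩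

variable [FiniteDimensional ℝ F]

theorem smooth_riggedField (hi : IsNullHypersurface F g i) (hg : IsLorentzMetric g)
    (hζ : IsRigging F i ζ) (p : L) : SmoothAt (riggedField F g i ζ) p := by
  refine (hi.isPseudoMetric_riggedMetric hg hζ).smoothAt_of_apply fun Z hZ => ?_
  simp only [hi.riggedMetric_riggedField hg hζ]
  exact hg.smooth_riggedForm hi.immersion.contMDiff hζ hZ

end IsNullHypersurface

end Radical

/-! ### Comparison of the rigged and ambient geometries. -/

section Rigged

attribute [local instance] isManifold_one isManifold_two isManifold_minSmoothness_two
  isManifold_minSmoothness_three isManifold_top_add_one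

variable {E : Type*} [NormedAddCommGroup E] [NormedSpace ℝ E]
  {M : Type*} [TopologicalSpace M] [ChartedSpace E M]
  {F : Type*} [NormedAddCommGroup F] [NormedSpace ℝ F]
  {L : Type*} [TopologicalSpace L] [ChartedSpace F L]
  {g : BilinField E M} {i : L → M} {ζ : VField E M} {p : L} {X Y Z V : VField F L}

/-- In the Koszul formula every `ω ⊗ ω` term has a factor `ω(V)` or `ω(Z)`, except the one pairing
`[V, Z]` with `U`. -/
theorem koszul_riggedMetric (U : VField F L)
    (hV : ∀ᶠ q in 𝓝 p, riggedForm F g i ζ q (V q) = 0)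
    (hZ : ∀ᶠ q in 𝓝 p, riggedForm F g i ζ q (Z q) = 0) :
    koszul (riggedMetric F g i ζ) U V Z p = koszul (pullbackForm F g i) U V Z p
      - (1 / 2) * (riggedForm F g i ζ p (bracket V Z p) * riggedForm F g i ζ p (U p)) := by
  simp only [koszul]
  rw [dirDeriv_congr (X := U) (f := fun q => riggedMetric F g i ζ q (V q) (Z q))
      (f' := fun q => pullbackForm F g i q (V q) (Z q))
      (hV.mono fun q hq => by simp only [riggedMetric_eq, hq, zero_mul, add_zero]),
    dirDeriv_congr (X := V) (f := fun q => riggedMetric F g i ζ q (Z q) (U q))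
      (f' := fun q => pullbackForm F g i q (Z q) (U q))
      (hZ.mono fun q hq => by simp only [riggedMetric_eq, hq, zero_mul, add_zero]),
    dirDeriv_congr (X := Z) (f := fun q => riggedMetric F g i ζ q (U q) (V q))
      (f' := fun q => pullbackForm F g i q (U q) (V q))
      (hV.mono fun q hq => by simp only [riggedMetric_eq, hq, mul_zero, add_zero])]
  simp only [riggedMetric_eq, hV.self_of_nhds, hZ.self_of_nhds]
  ring

variable [FiniteDimensional ℝ E] [IsManifold 𝓘(ℝ, E) ∞ M] [FiniteDimensional ℝ F]
  [IsManifold 𝓘(ℝ, F) ∞ L]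

namespace IsNullHypersurface

theorem isRiemannianFlow (hi : IsNullHypersurface F g i) (hg : IsLorentzMetric g)
    (hgeod : IsTotallyGeodesic F g i) (hζ : IsRigging F i ζ) :
    IsRiemannianFlow (riggedMetric F g i ζ) (riggedField F g i ζ) where
  smooth_field := hi.smooth_riggedField hg hζ
  ne_zero p h0 := by
    have := (hi.riggedField_spec hg hζ p).1
    rw [h0, map_zero] at this
    exact zero_ne_one this
  symm := (hi.isPseudoMetric_riggedMetric hg hζ).symm
  pos := hi.riggedMetric_pos hg hζ
  smooth_metric := (hi.isPseudoMetric_riggedMetric hg hζ).smooth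
  holonomy_invariant p V X Y hV hX hY hVξ hXξ hYξ := by
    have hk := hg.isSmoothForm_pullbackForm hi.immersion.contMDiff
    have hgM := hg.isPseudoMetric
    have hXω : ∀ᶠ q in 𝓝 p, riggedForm F g i ζ q (X q) = 0 := hXξ.mono fun q hq => by
      rwa [hi.riggedMetric_riggedField_right hg hζ] at hq
    have hYω : ∀ᶠ q in 𝓝 p, riggedForm F g i ζ q (Y q) = 0 := hYξ.mono fun q hq => by
      rwa [hi.riggedMetric_riggedField_right hg hζ] at hq
    have hξ : ∀ {Z : VField F L}, riggedForm F g i ζ p (Z p) = 0 →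
        riggedMetric F g i ζ p (riggedField F g i ζ p) (Z p) = 0 := fun h => by
      rw [hi.riggedMetric_riggedField hg hζ, h]
    have hVnull : ∀ᶠ q in 𝓝 p, ∀ v, pullbackForm F g i q (V q) v = 0 := hVξ.mono fun q hq v => by
      rw [horizontal, sub_eq_zero, vertical] at hq
      rw [hq, map_smul, smul_apply, (hi.riggedField_spec hg hζ q).2, smul_zero]
    obtain ⟨V', hV', hVV'⟩ := exists_related (hi.immersion.isImmersionAt p) hV
    -- Here total geodesy enters: `∇_A B` is tangent to `L`, so its product with the null `V`
    -- vanishes; metric compatibility moves the derivative onto `V`.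
    have hzero : ∀ {A B : VField F L}, SmoothAt A p → SmoothAt B p →
        koszul (pullbackForm F g i) A V B p = 0 := by
      intro A B hA hB
      obtain ⟨A', hA', hAA'⟩ := exists_related (hi.immersion.isImmersionAt p) hA
      obtain ⟨B', hB', hBB'⟩ := exists_related (hi.immersion.isImmersionAt p) hB
      have h1 := hk.koszul_add_koszul A V B p
      rw [dirDeriv_eq_zero (hVnull.mono fun q hq => hq (B q)),
        (hg.koszul_pullbackForm hi.immersion.contMDiff hA hB hV hA' hB' hV' hAA' hBB'
          hVV').eq_of_nhds, ← hgM.leviCivita_apply hA'.diff hB'.diff hV'.diff] at h1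
      obtain ⟨w, hw⟩ := hgeod p A' B' hA' hB' (hAA'.mono fun q hq => ⟨_, hq⟩)
        (hBB'.mono fun q hq => ⟨_, hq⟩)
      rw [← hw, ← hVV'.self_of_nhds, hg.symm, ← pullbackForm_apply, hVnull.self_of_nhds,
        add_zero] at h1
      exact h1
    -- On the screen `h` is `i^*g`, and the Koszul identities turn its Lie derivative along `V` into
    -- a sum of two terms of the form `hzero`.
    rw [apply_horizontal (hξ hYω.self_of_nhds), (hi.isPseudoMetric_riggedMetric hg hζ).symm p (X p),
      apply_horizontal (hξ hXω.self_of_nhds), riggedMetric_eq, riggedMetric_eq,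
      hXω.self_of_nhds, hYω.self_of_nhds, mul_zero, add_zero, mul_zero, add_zero,
      dirDeriv_congr (f' := fun q => pullbackForm F g i q (X q) (Y q))
        (hXω.mono fun q hq => by simp only [riggedMetric_eq, hq, zero_mul, add_zero]),
      ← hk.koszul_sub_koszul_swap, ← hk.koszul_sub_koszul_swap, ← hk.koszul_add_koszul,
      hzero hX hY, hzero hY hX]
    ring

/-- For sections of the screen distribution, the two Levi-Civita derivatives differ by a multiple
of the rigged field. -/
theorem exists_diff_eq_leviCivita (hi : IsNullHypersurface F g i) (hg : IsLorentzMetric g)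
    (hgeod : IsTotallyGeodesic F g i) (hζ : IsRigging F i ζ) {X' Y' : VField E M}
    (hX : SmoothAt X p) (hY : SmoothAt Y p) (hX' : SmoothAt X' (i p)) (hY' : SmoothAt Y' (i p))
    (hXX' : ∀ᶠ q in 𝓝 p, diff E F i q (X q) = X' (i q))
    (hYY' : ∀ᶠ q in 𝓝 p, diff E F i q (Y q) = Y' (i q))
    (hXω : ∀ᶠ q in 𝓝 p, riggedForm F g i ζ q (X q) = 0)
    (hYω : ∀ᶠ q in 𝓝 p, riggedForm F g i ζ q (Y q) = 0) :
    ∃ c : ℝ, diff E F i p (leviCivita (riggedMetric F g i ζ) X Y p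
      + c • riggedField F g i ζ p) = leviCivita g X' Y' (i p) := by
  have hh := hi.isPseudoMetric_riggedMetric hg hζ
  have hF := hi.isRiemannianFlow hg hgeod hζ
  obtain ⟨w, hw⟩ := hgeod p X' Y' hX' hY' (hXX'.mono fun q hq => ⟨_, hq⟩)
    (hYY'.mono fun q hq => ⟨_, hq⟩)
  -- The test field is the screen part of the difference `a` itself. Since `a` is orthogonal to
  -- screen test fields, its screen part has zero `h`-norm, leaving `a = ω(a) ξ`.
  let a : TangentSpace 𝓘(ℝ, F) p := w - leviCivita (riggedMetric F g i ζ) X Y p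
  let Z : VField F L := horizontal (riggedMetric F g i ζ) (riggedField F g i ζ)
    (FiberBundle.extend F a)
  have hZ : SmoothAt Z p := hF.smooth_horizontal (smoothAt_extend a)
  have hunit : ∀ q, riggedMetric F g i ζ q (riggedField F g i ζ q) (riggedField F g i ζ q) = 1 :=
    fun q => by rw [hi.riggedMetric_riggedField hg hζ, (hi.riggedField_spec hg hζ q).1]
  have hZω : ∀ q, riggedForm F g i ζ q (Z q) = 0 := fun q => by
    rw [← hi.riggedMetric_riggedField_right hg hζ]
    simp only [Z, horizontal, vertical_apply (hunit q)]
    rw [map_sub, map_smul, sub_apply, smul_apply, hunit, smul_eq_mul, mul_one, sub_self]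
  obtain ⟨Z', hZ', hZZ'⟩ := exists_related (hi.immersion.isImmersionAt p) hZ
  have haZ : riggedMetric F g i ζ p a (Z p) = 0 := by
    have h1 : riggedMetric F g i ζ p w (Z p) = koszul (riggedMetric F g i ζ) X Y Z p := by
      rw [riggedMetric_eq, hZω, mul_zero, add_zero, pullbackForm_apply, hw, hZZ'.self_of_nhds,
        hg.isPseudoMetric.leviCivita_apply hX'.diff hY'.diff hZ'.diff,
        koszul_riggedMetric X hYω (Filter.Eventually.of_forall hZω), hXω.self_of_nhds,
        (hg.koszul_pullbackForm hi.immersion.contMDiff hX hY hZ hX' hY' hZ' hXX' hYY'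
          hZZ').eq_of_nhds]
      ring
    simp only [a]
    rw [map_sub, sub_apply, h1, hh.leviCivita_apply hX.diff hY.diff hZ.diff, sub_self]
  have hZp : Z p = a - riggedForm F g i ζ p a • riggedField F g i ζ p := by
    simp only [Z, horizontal, vertical_apply (hunit p), extend_self]
    rw [hi.riggedMetric_riggedField_right hg hζ]
  have hZZ : riggedMetric F g i ζ p (Z p) (Z p) = 0 := by
    have h2 : riggedMetric F g i ζ p (Z p) (Z p) = riggedMetric F g i ζ p a (Z p)
        - riggedForm F g i ζ p a * riggedMetric F g i ζ p (riggedField F g i ζ p) (Z p) := by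
      have h3 : ∀ (b z : TangentSpace 𝓘(ℝ, F) p) (c : ℝ),
          riggedMetric F g i ζ p (b - c • riggedField F g i ζ p) z = riggedMetric F g i ζ p b z
            - c * riggedMetric F g i ζ p (riggedField F g i ζ p) z := fun b z c => by
        rw [map_sub, map_smul, sub_apply, smul_apply, smul_eq_mul]
      have h4 := h3 a (Z p) (riggedForm F g i ζ p a)
      rwa [← hZp] at h4
    rw [h2, haZ, hi.riggedMetric_riggedField hg hζ, hZω, mul_zero, sub_zero]
  have hZ0 : Z p = 0 := by
    by_contra h0
    exact (hi.riggedMetric_pos hg hζ p _ h0).ne' hZZ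
  refine ⟨riggedForm F g i ζ p a, ?_⟩
  rw [hZp, sub_eq_zero] at hZ0
  rw [← hZ0, ← hw]
  congr 1
  simp [a]

/-- The sectional curvatures of the screen planes in the ambient and in the rigged metric. -/
theorem apply_curvature_eq (hi : IsNullHypersurface F g i) (hg : IsLorentzMetric g)
    (hgeod : IsTotallyGeodesic F g i) (hζ : IsRigging F i ζ) {X' Y' : VField E M}
    (hX : SmoothAt X p) (hY : SmoothAt Y p) (hX' : SmoothAt X' (i p)) (hY' : SmoothAt Y' (i p))
    (hXX' : ∀ᶠ q in 𝓝 p, diff E F i q (X q) = X' (i q))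
    (hYY' : ∀ᶠ q in 𝓝 p, diff E F i q (Y q) = Y' (i q))
    (hXω : ∀ᶠ q in 𝓝 p, riggedForm F g i ζ q (X q) = 0)
    (hYω : ∀ᶠ q in 𝓝 p, riggedForm F g i ζ q (Y q) = 0) :
    g (i p) (curvature (leviCivita g) X' Y' Y' (i p)) (X' (i p))
      = riggedMetric F g i ζ p (curvature (leviCivita (riggedMetric F g i ζ)) X Y Y p) (X p)
        + (3 / 4) * riggedForm F g i ζ p (bracket X Y p) ^ 2 := by
  have hh := hi.isPseudoMetric_riggedMetric hg hζ
  have hF := hi.isRiemannianFlow hg hgeod hζ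
  have hgM := hg.isPseudoMetric
  have hi' := hi.immersion.contMDiff
  have hXξ : ∀ᶠ q in 𝓝 p, riggedMetric F g i ζ q (X q) (riggedField F g i ζ q) = 0 :=
    hXω.mono fun q hq => by rw [hi.riggedMetric_riggedField_right hg hζ, hq]
  have hYξ : ∀ᶠ q in 𝓝 p, riggedMetric F g i ζ q (Y q) (riggedField F g i ζ q) = 0 :=
    hYω.mono fun q hq => by rw [hi.riggedMetric_riggedField_right hg hζ, hq]
  -- With all three fields in the screen, the correction in `koszul_riggedMetric` vanishes near `p`,
  -- so the Koszul functions have the same derivatives.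
  have hderiv : ∀ {A B C : VField F L} {A' B' C' : VField E M},
      SmoothAt A p → SmoothAt B p → SmoothAt C p →
      SmoothAt A' (i p) → SmoothAt B' (i p) → SmoothAt C' (i p) →
      (∀ᶠ q in 𝓝 p, diff E F i q (A q) = A' (i q)) →
      (∀ᶠ q in 𝓝 p, diff E F i q (B q) = B' (i q)) →
      (∀ᶠ q in 𝓝 p, diff E F i q (C q) = C' (i q)) →
      (∀ᶠ q in 𝓝 p, riggedForm F g i ζ q (A q) = 0) →
      (∀ᶠ q in 𝓝 p, riggedForm F g i ζ q (B q) = 0) →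
      (∀ᶠ q in 𝓝 p, riggedForm F g i ζ q (C q) = 0) →
      dirDeriv C' (koszul g A' B' X') (i p)
        = dirDeriv C (koszul (riggedMetric F g i ζ) A B X) p := by
    intro A B C A' B' C' hA hB hC hA' hB' hC' hAA' hBB' hCC' hAω hBω hCω
    rw [← dirDeriv_comp (X := C) ((hi' p).mdifferentiableAt (by simp))
      (SmoothFnAt.diff (hgM.smooth_koszul hA' hB' hX')) hCC'.self_of_nhds]
    refine dirDeriv_congr ?_
    filter_upwards [hg.koszul_pullbackForm hi' hA hB hX hA' hB' hX' hAA' hBB' hXX', hAω,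
      hBω.eventually_nhds, hXω.eventually_nhds] with q h1 h2 h3 h4
    rw [← h1, koszul_riggedMetric A h3 h4, h2]
    ring
  have hnull := (hi.riggedField_spec hg hζ p).2
  -- The induced form ignores multiples of `ξ` and equals `h - ω ⊗ ω`.
  have hprod : ∀ {u v : TangentSpace 𝓘(ℝ, F) p} {c d : ℝ},
      g (i p) (diff E F i p (u + c • riggedField F g i ζ p))
        (diff E F i p (v + d • riggedField F g i ζ p))
      = riggedMetric F g i ζ p u v
        - riggedMetric F g i ζ p u (riggedField F g i ζ p)
          * riggedMetric F g i ζ p v (riggedField F g i ζ p) := by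
    intro u v c d
    have hsymm : pullbackForm F g i p u (riggedField F g i ζ p) = 0 := by
      rw [(hg.isSmoothForm_pullbackForm hi').symm, hnull]
    rw [← pullbackForm_apply, hi.riggedMetric_riggedField_right hg hζ,
      hi.riggedMetric_riggedField_right hg hζ, riggedMetric_eq]
    simp only [map_add, map_smul, add_apply, smul_apply, hnull, hsymm, smul_zero, add_zero]
    ring
  -- `[X, Y]` need not lie in the screen, so here the correction survives.
  have hlast : koszul g (bracket X' Y') Y' X' (i p)
      = koszul (riggedMetric F g i ζ) (bracket X Y) Y X p
        - (1 / 2) * riggedForm F g i ζ p (bracket X Y p) ^ 2 := by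
    have hbr : ∀ᶠ q in 𝓝 p, diff E F i q (bracket X Y q) = bracket X' Y' (i q) := by
      have hc := (hi' p).continuousAt
      filter_upwards [hX.eventually_contMDiffAt 2, hY.eventually_contMDiffAt 2,
        hc.eventually (hX'.eventually_contMDiffAt 2), hc.eventually (hY'.eventually_contMDiffAt 2),
        hXX'.eventually_nhds, hYY'.eventually_nhds] with q x y x' y' xx yy
        using diff_bracket hi' x y x' y' xx yy
    have h1 := (hg.koszul_pullbackForm hi' (hX.bracket hY) hY hX (hX'.bracket hY') hY' hX'
      hbr hYY' hXX').eq_of_nhds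
    rw [← h1, koszul_riggedMetric _ hYω hXω, bracket_swap Y X, map_neg]
    ring
  obtain ⟨c1, h1⟩ := hi.exists_diff_eq_leviCivita hg hgeod hζ hX hX hX' hX' hXX' hXX' hXω hXω
  obtain ⟨c2, h2⟩ := hi.exists_diff_eq_leviCivita hg hgeod hζ hY hY hY' hY' hYY' hYY' hYω hYω
  obtain ⟨c3, h3⟩ := hi.exists_diff_eq_leviCivita hg hgeod hζ hX hY hX' hY' hXX' hYY' hXω hYω
  obtain ⟨c4, h4⟩ := hi.exists_diff_eq_leviCivita hg hgeod hζ hY hX hY' hX' hYY' hXX' hYω hXω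
  -- Again `3 / 4 = 1 / 4 + 1 / 2`: the mixed product in `hprod`, then `hlast`.
  rw [hgM.apply_curvature hX' hY', hh.apply_curvature hX hY, hlast,
    hderiv hY hY hX hY' hY' hX' hYY' hYY' hXX' hYω hYω hXω,
    hderiv hX hY hY hX' hY' hY' hXX' hYY' hYY' hXω hYω hYω, ← h1, ← h2, ← h3, ← h4, hprod, hprod,
    hF.apply_leviCivita_field hX hX hXξ hXξ, hF.apply_leviCivita_field hY hY hYξ hYξ,
    hF.apply_leviCivita_field hX hY hXξ hYξ, hF.apply_leviCivita_field hY hX hYξ hXξ,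
    bracket_swap Y X, show bracket X X p = 0 from congrFun VectorField.mlieBracket_self p,
    ← hi.riggedMetric_riggedField_right hg hζ p (bracket X Y p)]
  simp only [map_neg, neg_apply, map_zero, zero_apply]
  ring

end IsNullHypersurface

end Rigged
end RiggedNull
end

/-! ### The curvature identities assembled. -/

theorem mainTheorem1
    {E : Type*} [NormedAddCommGroup E] [NormedSpace ℝ E] [FiniteDimensional ℝ E]
    {M : Type*} [TopologicalSpace M] [ChartedSpace E M] [IsManifold 𝓘(ℝ, E) ∞ M]
    {F : Type*} [NormedAddCommGroup F] [NormedSpace ℝ F] [FiniteDimensional ℝ F]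
    {L : Type*} [TopologicalSpace L] [ChartedSpace F L] [IsManifold 𝓘(ℝ, F) ∞ L]
    (g : BilinField E M) (hg : IsLorentzMetric g)
    (i : L → M) (hi : IsNullHypersurface F g i)
    (hgeod : IsTotallyGeodesic F g i)
    (ζ : VField E M) (hζ : IsRigging F i ζ) :
    IsRiemannianFlow (riggedMetric F g i ζ) (riggedField F g i ζ) ∧
    -- `X`, `Y` are local smooth sections of the screen distribution, orthonormal at `p`;
    -- `X'`, `Y'` are arbitrary local smooth vector fields of `M` with the same values at `p`.
    ∀ (p : L) (X Y : VField F L) (X' Y' : VField E M),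
      SmoothAt X p → SmoothAt Y p →
      (∀ᶠ q in 𝓝 p, riggedForm F g i ζ q (X q) = 0) →
      (∀ᶠ q in 𝓝 p, riggedForm F g i ζ q (Y q) = 0) →
      riggedMetric F g i ζ p (X p) (X p) = 1 →
      riggedMetric F g i ζ p (Y p) (Y p) = 1 →
      riggedMetric F g i ζ p (X p) (Y p) = 0 →
      SmoothAt X' (i p) → SmoothAt Y' (i p) →
      X' (i p) = diff E F i p (X p) → Y' (i p) = diff E F i p (Y p) →
      transverseSectionalCurvature (riggedMetric F g i ζ) (riggedField F g i ζ) X Y p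
          = sectionalCurvature (riggedMetric F g i ζ) X Y p
            + (3 / 4) * extDerivOneForm (riggedForm F g i ζ) X Y p ^ 2 ∧
        sectionalCurvature (riggedMetric F g i ζ) X Y p
            + (3 / 4) * extDerivOneForm (riggedForm F g i ζ) X Y p ^ 2
          = sectionalCurvature g X' Y' (i p) := by
  have hF := hi.isRiemannianFlow hg hgeod hζ
  refine ⟨hF, fun p X Y X' Y' hX hY hXω hYω hXX hYY hXY hX' hY' hXX' hYY' => ?_⟩
  -- `X'` and `Y'` match the screen sections only at `i p`; the comparison needs fields related to
  -- them on a whole neighbourhood.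
  obtain ⟨X₁, hX₁, hXX₁⟩ := exists_related (hi.immersion.isImmersionAt p) hX
  obtain ⟨Y₁, hY₁, hYY₁⟩ := exists_related (hi.immersion.isImmersionAt p) hY
  have hunit : ∀ q, riggedMetric F g i ζ q (riggedField F g i ζ q) (riggedField F g i ζ q) = 1 :=
    fun q => by rw [hi.riggedMetric_riggedField hg hζ, (hi.riggedField_spec hg hζ q).1]
  have hXξ : ∀ᶠ q in 𝓝 p, riggedMetric F g i ζ q (X q) (riggedField F g i ζ q) = 0 :=
    hXω.mono fun q hq => by rw [hi.riggedMetric_riggedField_right hg hζ, hq]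
  have hYξ : ∀ᶠ q in 𝓝 p, riggedMetric F g i ζ q (Y q) (riggedField F g i ζ q) = 0 :=
    hYω.mono fun q hq => by rw [hi.riggedMetric_riggedField_right hg hζ, hq]
  have hdω : extDerivOneForm (riggedForm F g i ζ) X Y p
      = -riggedForm F g i ζ p (bracket X Y p) := by
    rw [extDerivOneForm, dirDeriv_eq_zero hXω, dirDeriv_eq_zero hYω]
    ring
  have hXp := hXω.self_of_nhds
  have hYp := hYω.self_of_nhds
  -- On the screen, orthonormality for `h` is orthonormality for `g`, so both sectional curvature
  -- denominators equal `1`.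
  rw [riggedMetric_eq, hXp, mul_zero, add_zero, pullbackForm_apply, ← hXX'] at hXX
  rw [riggedMetric_eq, hYp, mul_zero, add_zero, pullbackForm_apply, ← hYY'] at hYY
  rw [riggedMetric_eq, hYp, mul_zero, add_zero, pullbackForm_apply, ← hXX', ← hYY'] at hXY
  have hgXY : sectionalCurvature g X' Y' (i p)
      = g (i p) (curvature (leviCivita g) X₁ Y₁ Y₁ (i p)) (X₁ (i p)) := by
    have e1 : X' (i p) = X₁ (i p) := hXX'.trans hXX₁.self_of_nhds
    have e2 : Y' (i p) = Y₁ (i p) := hYY'.trans hYY₁.self_of_nhds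
    rw [sectionalCurvature, hXX, hYY, hXY,
      hg.isPseudoMetric.curvature_congr hX' hX₁ hY' hY₁ hY' hY₁ e1 e2 e2, e1]
    norm_num
  have hrXY : sectionalCurvature (riggedMetric F g i ζ) X Y p
      = riggedMetric F g i ζ p (curvature (leviCivita (riggedMetric F g i ζ)) X Y Y p) (X p) := by
    rw [sectionalCurvature, riggedMetric_eq g i ζ p (X p) (X p),
      riggedMetric_eq g i ζ p (Y p) (Y p), riggedMetric_eq g i ζ p (X p) (Y p), hXp, hYp,
      pullbackForm_apply, pullbackForm_apply, pullbackForm_apply, ← hXX', ← hYY', hXX, hYY, hXY]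
    norm_num
  rw [hgXY, hrXY, hdω, neg_sq]
  refine ⟨?_, ?_⟩
  · rw [hF.transverseSectionalCurvature_eq hunit hX hY hXξ hYξ,
      hi.riggedMetric_riggedField_right hg hζ]
  · rw [hi.apply_curvature_eq hg hgeod hζ hX hY hX₁ hY₁ hXX₁ hYY₁ hXω hYω]
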